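/- Let $d\ge 1$ be an integer. For $j\in\mathbb N_0$ let $$\psi_j(x)=\frac{1}{\sqrt{2^j\,j!\,\sqrt\pi}}\,H_j(x)\,e^{-x^2/2}\qquad(x\in\mathbb R),$$ where $H_j$ is the $j$-th (physicists') Hermite polynomial. For $n\in\mathbb N$ and $x,x'\in\mathbb R^d$ let $$\mathcal K_n^{\rm Fermi}(x,x')=\sum_{\substack{j_1,\dots,j_d\ge 0\\ j_1+\cdots+j_d\le n-1}}\ \prod_{k=1}^d\psi_{j_k}(x_k)\,\psi_{j_k}(x_k')$$ be the kernel of the fermionic process of the $d$-dimensional harmonic oscillator, and let $$\mathbb K_n^{\rm Fermi}(X,X')=n^{d/2}\,\mathcal K_n^{\rm Fermi}(\sqrt n\,X,\sqrt n\,X')$$ be the rescaled kernel. Write $|X|$ for the Euclidean norm on $\mathbb R^d$. Then: (i) As $n\to\infty$, for $|X|<\sqrt 2$, $$\frac{1}{n^d/d!}\,\mathbb K_n^{\rm Fermi}(X,X)=\frac{d!}{2^d\pi^{d/2}}\,\frac{(2-|X|^2)^{d/2}}{\Gamma\left(\frac d2+1\right)}+\mathcal O\left(\frac1n\right),$$ uniformly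 for $X$ in compact subsets of $\{X\in\mathbb R^d:|X|<\sqrt2\}$. (ii) For $|X|>\sqrt2$ the density $\mathbb K_n^{\rm Fermi}(X,X)$ vanishes exponentially as $n\to\infty$, uniformly on compact subsets: for every compact $K\subset\{X\in\mathbb R^d:|X|>\sqrt2\}$ there are constants $C,c>0$ such that $\mathbb K_n^{\rm Fermi}(X,X)\le C e^{-cn}$ for all $X\in K$ and all sufficiently large $n$. -/

import Mathlib

open Real Filter Finset
open scoped Nat

/-- The physicists' Hermite polynomial `H_j` (orthogonal for the weight `exp (-x ^ 2)`, leading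
coefficient `2 ^ j`), as a function on `ℝ`. It is expressed by Mathlib's `Polynomial.hermite j`,
the probabilists' (monic) Hermite polynomial: `H_j(x) = 2 ^ (j / 2) He_j(√2 x)`. -/
noncomputable def hermiteH (j : ℕ) (x : ℝ) : ℝ :=
  √2 ^ j * Polynomial.aeval (√2 * x) (Polynomial.hermite j)

/-- The one-dimensional harmonic-oscillator eigenfunction `ψ_j`, normalized in `L²(ℝ)`. -/
noncomputable def oscPsi (j : ℕ) (x : ℝ) : ℝ :=
  1 / √(2 ^ j * (j ! : ℝ) * √π) * hermiteH j x * exp (-(1 / 2) * x ^ 2)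

/-- The `d`-dimensional eigenfunction `Ψ_{j₁,…,j_d}(x) = ψ_{j₁}(x₁) ⋯ ψ_{j_d}(x_d)`. -/
noncomputable def oscPsiProd {d : ℕ} (j : Fin d → ℕ) (x : EuclideanSpace ℝ (Fin d)) : ℝ :=
  ∏ k, oscPsi (j k) (x k)

/-- The finite set of multi-indices `j ∈ ℕ^d` with `j₁ + ⋯ + j_d < n` (each entry is then
automatically `< n`). -/
def multiIdxLT (d n : ℕ) : Finset (Fin d → ℕ) :=
  {j ∈ Fintype.piFinset (fun _ : Fin d => Finset.range n) | ∑ k, j k < n}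

theorem mem_multiIdxLT {d n : ℕ} (j : Fin d → ℕ) :
    j ∈ multiIdxLT d n ↔ ∑ k, j k < n := by
  simp only [multiIdxLT, Finset.mem_filter, Fintype.mem_piFinset, Finset.mem_range,
    and_iff_right_iff_imp]
  intro h k
  exact lt_of_le_of_lt (Finset.single_le_sum (fun i _ => Nat.zero_le (j i)) (Finset.mem_univ k)) h

/-- The kernel of the fermionic process of the `d`-dimensional harmonic oscillator. -/
noncomputable def fermiKernel {d : ℕ} (n : ℕ) (x x' : EuclideanSpace ℝ (Fin d)) : ℝ :=
  ∑ j ∈ multiIdxLT d n, oscPsiProd j x * oscPsiProd j x'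

/-- The kernel rescaled by `√n`: `n^{d/2} K_n(√n X, √n X')`. -/
noncomputable def scaledFermiKernel {d : ℕ} (n : ℕ) (X X' : EuclideanSpace ℝ (Fin d)) : ℝ :=
  (n : ℝ) ^ ((d : ℝ) / 2) * fermiKernel n (√(n : ℝ) • X) (√(n : ℝ) • X')

/-! On the diagonal, Mehler's formula reads `∑ ψ_j(x)² X^j = (π(1 - X²))^(-1/2) exp(-x² (1 - X)/(1 +
X))`. It is used only through differential equations for formal power series: the ladder relations
give a first-order equation in `x` (`isRadialFlow_oscSeries`), whose solutions are determined by
their value at `0`. Hence the product over the coordinates depends on the norm alone, and the kernel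
is a radial function `K_n(r)`, the sum of the first `n` shell densities `p_k(r)`.

Bulk. The equations in `r` and in `X` combine to `(2n - r²) K_n' + d r K_n = V'`, with `V` an
explicit combination of shell densities and `K_n` (`hasDerivAt_kernelPotential`). So `K_n (2n -
r²)^(-d/2)` has derivative `V' (2n - r²)^(-d/2 - 1)`. Since `V = O(n^(d/2))` in the bulk,
integration by parts shows that this quotient is constant up to `O(1/n)`. The constant is read off
at `r = 0`, where `K_n` is a quotient of Gamma values. The bound on `V` requires `p_n = O(n^(d/2 -
1))`: an energy estimate for `d = 1`, a convolution for `d = 2`, and a comparison with the kernel in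
dimension `d - 2` for `d ≥ 3`.

Outside. A Chernoff argument: `∑ q^k K_k` with `q < 1` is at most `exp(-r² (1 - q)/(1 + q))` times
its value at the origin (`kernelSum_weighted_le`). Taking `q` close to `1`, depending on the
distance to the critical sphere, makes the Gaussian gain exceed the cost `q^(-n)`. -/

section Ladder

/-! ### Ladder operators for Hermite functions -/

theorem Polynomial.derivative_hermite_succ (n : ℕ) :
    Polynomial.derivative (Polynomial.hermite (n + 1))
      = ((n : Polynomial ℤ) + 1) * Polynomial.hermite n := by
  induction n with
  | zero => simp [Polynomial.hermite_zero]
  | succ n ih =>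
    rw [Polynomial.hermite_succ (n + 1), Polynomial.derivative_sub, Polynomial.derivative_mul, ih,
      Polynomial.derivative_mul]
    have := Polynomial.hermite_succ n
    simp only [Polynomial.derivative_X, Polynomial.derivative_add, Polynomial.derivative_natCast,
      Polynomial.derivative_one]
    push_cast
    linear_combination -((n : Polynomial ℤ) + 1) * this

/-- The normalization constant of `oscPsi`. -/
noncomputable def oscNorm (j : ℕ) : ℝ := 1 / √(2 ^ j * (j ! : ℝ) * √π)

theorem sqrt_mul_oscNorm_succ (n : ℕ) : √(2 * (n + 1)) * oscNorm (n + 1) = oscNorm n := by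
  have h : (2 : ℝ) ^ (n + 1) * ((n + 1)! : ℝ) * √π
      = 2 * (n + 1) * (2 ^ n * (n ! : ℝ) * √π) := by
    rw [Nat.factorial_succ]; push_cast; ring
  have h1 : (0 : ℝ) < 2 * (n + 1) := by positivity
  have h2 : √(2 * ((n : ℝ) + 1)) ≠ 0 := (Real.sqrt_pos.2 h1).ne'
  rw [oscNorm, oscNorm, h, Real.sqrt_mul h1.le]
  field_simp

theorem hasDerivAt_oscPsi_aux (j : ℕ) (x : ℝ) :
    HasDerivAt (oscPsi j)
      (oscNorm j * (√2 ^ j * (√2 * Polynomial.aeval (√2 * x)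
        (Polynomial.derivative (Polynomial.hermite j)) - x *
        Polynomial.aeval (√2 * x) (Polynomial.hermite j))) * exp (-(1 / 2) * x ^ 2)) x := by
  have h1 : HasDerivAt (fun x : ℝ => √2 * x) √2 x := by
    simpa using (hasDerivAt_id x).const_mul √2
  have h2 := (Polynomial.hasDerivAt_aeval (Polynomial.hermite j) (√2 * x)).comp x h1
  have h3 : HasDerivAt (fun x : ℝ => exp (-(1 / 2) * x ^ 2)) (exp (-(1 / 2) * x ^ 2) * (-x)) x := by
    have := ((hasDerivAt_pow 2 x).const_mul (-(1 / 2 : ℝ))).exp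
    convert this using 2
    norm_num
    ring
  have h4 := ((h2.const_mul (√2 ^ j)).const_mul (oscNorm j)).mul h3
  refine HasDerivAt.congr_deriv (f := oscPsi j) h4 ?_
  simp only [Function.comp]
  ring

/-- Lowering operator: `ψ_{n+1}' = √(2(n+1)) ψ_n - x ψ_{n+1}`. -/
theorem hasDerivAt_oscPsi_succ (n : ℕ) (x : ℝ) :
    HasDerivAt (oscPsi (n + 1)) (√(2 * (n + 1)) * oscPsi n x - x * oscPsi (n + 1) x) x := by
  convert hasDerivAt_oscPsi_aux (n + 1) x using 1
  rw [Polynomial.derivative_hermite_succ]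
  have h := sqrt_mul_oscNorm_succ n
  have h1 : √(2 * ((n : ℝ) + 1)) * √(2 * ((n : ℝ) + 1)) = 2 * (n + 1) :=
    Real.mul_self_sqrt (by positivity)
  have h2 : √2 * √2 = 2 := Real.mul_self_sqrt (by norm_num)
  change _ * (oscNorm n * _ * _) - x * (oscNorm (n + 1) * _ * _) = _
  rw [← h]
  simp only [hermiteH, map_mul, map_add, map_natCast, map_one, pow_succ √2 n]
  linear_combination (√2 ^ n * oscNorm (n + 1) * (Polynomial.aeval (√2 * x)) (Polynomial.hermite n)
    * exp (-(1 / 2) * x ^ 2)) * (h1 - (n + 1) * h2)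

/-- Raising operator: `ψ_n' = x ψ_n - √(2(n+1)) ψ_{n+1}`. -/
theorem hasDerivAt_oscPsi (n : ℕ) (x : ℝ) :
    HasDerivAt (oscPsi n) (x * oscPsi n x - √(2 * (n + 1)) * oscPsi (n + 1) x) x := by
  convert hasDerivAt_oscPsi_aux n x using 1
  have h := sqrt_mul_oscNorm_succ n
  have h2 : √2 * √2 = 2 := Real.mul_self_sqrt (by norm_num)
  change x * (oscNorm n * _ * _) - _ * (oscNorm (n + 1) * _ * _) = _
  have h3 := congrArg (Polynomial.aeval (√2 * x)) (Polynomial.hermite_succ n)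
  simp only [map_sub, map_mul, Polynomial.aeval_X] at h3
  simp only [hermiteH, pow_succ √2 n, h3]
  set D := (Polynomial.aeval (√2 * x)) (Polynomial.derivative (Polynomial.hermite n))
  set G := (Polynomial.aeval (√2 * x)) (Polynomial.hermite n)
  linear_combination -(√2 ^ n * √2 * (√2 * x * G - D) * exp (-(1 / 2) * x ^ 2)) * h -
    (oscNorm n * √2 ^ n * x * G * exp (-(1 / 2) * x ^ 2)) * h2

theorem hasDerivAt_oscPsi_zero (x : ℝ) : HasDerivAt (oscPsi 0) (-x * oscPsi 0 x) x := by
  convert hasDerivAt_oscPsi_aux 0 x using 1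
  change -x * (oscNorm 0 * _ * _) = _
  simp [hermiteH]
  ring

theorem oscPsi_zero_zero_sq : oscPsi 0 0 ^ 2 = 1 / √π := by
  simp [oscPsi, hermiteH]

theorem oscPsi_one_zero : oscPsi 1 0 = 0 := by
  simp [oscPsi, hermiteH]

/-- The three-term recurrence at the origin. -/
theorem oscPsi_succ_succ_zero_sq (n : ℕ) :
    ((n : ℝ) + 2) * oscPsi (n + 2) 0 ^ 2 = (n + 1) * oscPsi n 0 ^ 2 := by
  -- Lowering and raising give two values for `ψ_{n+1}'(0)`; the terms with factor `x` vanish, and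
  -- squaring removes the sign.
  have h1 := (hasDerivAt_oscPsi_succ n 0).unique (hasDerivAt_oscPsi (n + 1) 0)
  simp only [zero_mul, sub_zero, zero_sub] at h1
  have h2 : (√(2 * ((n : ℝ) + 1)) * oscPsi n 0) ^ 2
      = (√(2 * (((n + 1 : ℕ) : ℝ) + 1)) * oscPsi (n + 1 + 1) 0) ^ 2 := by
    rw [h1]; ring
  rw [mul_pow, mul_pow, Real.sq_sqrt (by positivity), Real.sq_sqrt (by positivity)] at h2
  push_cast at h2
  linarith

end Ladder

/-! ### Differential equations for the generating functions -/

section Flow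

open PowerSeries

theorem neg_two_mul_C (a : ℝ) :
    (-2 : ℝ⟦X⟧) * PowerSeries.C a = PowerSeries.C (-2 * a) := by
  rw [map_mul, map_neg, map_ofNat]

/-- Coefficientwise differentiability of a curve of power series. -/
def HasCoeffDerivAt (u : ℝ → ℝ⟦X⟧) (u' : ℝ⟦X⟧) (s : ℝ) : Prop :=
  ∀ n, HasDerivAt (fun s => coeff n (u s)) (coeff n u') s

namespace HasCoeffDerivAt

variable {u v : ℝ → ℝ⟦X⟧} {u' v' : ℝ⟦X⟧} {s : ℝ}

theorem const (w : ℝ⟦X⟧) (s : ℝ) : HasCoeffDerivAt (fun _ => w) 0 s := fun n => by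
  simpa using hasDerivAt_const s (coeff n w)

theorem C {f : ℝ → ℝ} {f' : ℝ} (h : HasDerivAt f f' s) :
    HasCoeffDerivAt (fun s => PowerSeries.C (f s)) (PowerSeries.C f') s := fun n => by
  by_cases hn : n = 0
  · subst hn; simpa using h
  · simpa [PowerSeries.coeff_C, hn] using hasDerivAt_const s (0 : ℝ)

theorem add (hu : HasCoeffDerivAt u u' s) (hv : HasCoeffDerivAt v v' s) :
    HasCoeffDerivAt (fun s => u s + v s) (u' + v') s := fun n => by
  simpa only [map_add] using (hu n).fun_add (hv n)

theorem sub (hu : HasCoeffDerivAt u u' s) (hv : HasCoeffDerivAt v v' s) :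
    HasCoeffDerivAt (fun s => u s - v s) (u' - v') s := fun n => by
  simpa only [map_sub] using (hu n).fun_sub (hv n)

theorem mul (hu : HasCoeffDerivAt u u' s) (hv : HasCoeffDerivAt v v' s) :
    HasCoeffDerivAt (fun s => u s * v s) (u' * v s + u s * v') s := fun n => by
  simp only [map_add, coeff_mul, ← Finset.sum_add_distrib]
  exact HasDerivAt.fun_sum fun p _ => (hu p.1).mul (hv p.2)

theorem const_mul (w : ℝ⟦X⟧) (hu : HasCoeffDerivAt u u' s) :
    HasCoeffDerivAt (fun s => w * u s) (w * u') s := by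
  simpa using (const w s).mul hu

theorem comp_mul_left {c : ℝ} (hu : HasCoeffDerivAt u u' (c * s)) :
    HasCoeffDerivAt (fun s => u (c * s)) (PowerSeries.C c * u') s := fun n => by
  have h : HasDerivAt (fun s : ℝ => c * s) c s := by simpa using (hasDerivAt_id s).const_mul c
  refine HasDerivAt.congr_deriv (f := fun s => coeff n (u (c * s))) ((hu n).comp s h) ?_
  simp [mul_comm]

theorem derivative (hu : HasCoeffDerivAt u u' s) :
    HasCoeffDerivAt (fun s => d⁄dX ℝ (u s)) (d⁄dX ℝ u') s := fun n => by
  simpa only [coeff_derivative] using (hu (n + 1)).mul_const ((n : ℝ) + 1)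

end HasCoeffDerivAt

/-- The curve `u` solves `(1 + X) u' = -2 ρ s (1 - X) u`, so that formally
`u s = u 0 * exp (-ρ s² (1 - X) / (1 + X))`. -/
def IsRadialFlow (ρ : ℝ) (u : ℝ → ℝ⟦X⟧) : Prop :=
  ∃ u' : ℝ → ℝ⟦X⟧, ∀ s, HasCoeffDerivAt u (u' s) s ∧
    (1 + X) * u' s = -2 * PowerSeries.C (ρ * s) * ((1 - X) * u s)

namespace IsRadialFlow

variable {ρ σ : ℝ} {u v : ℝ → ℝ⟦X⟧}

theorem const (w : ℝ⟦X⟧) : IsRadialFlow 0 fun _ => w :=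
  ⟨fun _ => 0, fun s => ⟨HasCoeffDerivAt.const w s, by simp⟩⟩

theorem mul (hu : IsRadialFlow ρ u) (hv : IsRadialFlow σ v) :
    IsRadialFlow (ρ + σ) fun s => u s * v s := by
  obtain ⟨u', hu⟩ := hu
  obtain ⟨v', hv⟩ := hv
  refine ⟨fun s => u' s * v s + u s * v' s, fun s => ⟨(hu s).1.mul (hv s).1, ?_⟩⟩
  rw [add_mul ρ σ s, map_add]
  linear_combination v s * (hu s).2 + u s * (hv s).2

theorem sub (hu : IsRadialFlow ρ u) (hv : IsRadialFlow ρ v) :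
    IsRadialFlow ρ fun s => u s - v s := by
  obtain ⟨u', hu⟩ := hu
  obtain ⟨v', hv⟩ := hv
  refine ⟨fun s => u' s - v' s, fun s => ⟨(hu s).1.sub (hv s).1, ?_⟩⟩
  linear_combination (hu s).2 - (hv s).2

theorem comp_mul_left (hu : IsRadialFlow ρ u) (c : ℝ) :
    IsRadialFlow (ρ * c ^ 2) fun s => u (c * s) := by
  obtain ⟨u', hu⟩ := hu
  refine ⟨fun s => PowerSeries.C c * u' (c * s), fun s => ⟨(hu (c * s)).1.comp_mul_left, ?_⟩⟩
  have h : PowerSeries.C (ρ * c ^ 2 * s) = PowerSeries.C c * PowerSeries.C (ρ * (c * s)) := by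
    rw [← map_mul]; congr 1; ring
  rw [h]
  linear_combination PowerSeries.C c * (hu (c * s)).2

theorem prod {ι : Type*} (t : Finset ι) (ρ : ι → ℝ) (u : ι → ℝ → ℝ⟦X⟧)
    (h : ∀ i, IsRadialFlow (ρ i) (u i)) :
    IsRadialFlow (∑ i ∈ t, ρ i) fun s => ∏ i ∈ t, u i s := by
  classical
  induction t using Finset.induction_on with
  | empty => simpa using const 1
  | insert a t ha ih => simpa [Finset.prod_insert ha, Finset.sum_insert ha] using (h a).mul ih

/-- A scalar solution of `f' = -2 ρ s f` vanishing at `0` vanishes. -/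
theorem scalar_eq_zero {f : ℝ → ℝ} (hf : ∀ s, HasDerivAt f (-2 * (ρ * s) * f s) s) (h0 : f 0 = 0)
    (s : ℝ) : f s = 0 := by
  have h : ∀ s, HasDerivAt (fun s => f s * exp (ρ * s ^ 2)) 0 s := fun s => by
    have h1 : HasDerivAt (fun s : ℝ => exp (ρ * s ^ 2)) (exp (ρ * s ^ 2) * (ρ * (2 * s))) s := by
      have := ((hasDerivAt_pow 2 s).const_mul ρ).exp
      convert this using 2
      norm_num
    refine ((hf s).mul h1).congr_deriv ?_
    ring
  have h2 := is_const_of_deriv_eq_zero (fun s => (h s).differentiableAt) (fun s => (h s).deriv) s 0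
  simpa [h0] using h2

/-- Multiplication by `1 ± X` couples a coefficient only to the preceding one. Once that one
vanishes identically, so does its derivative, and a scalar linear equation remains. -/
theorem eq_zero (hu : IsRadialFlow ρ u) (h0 : u 0 = 0) (s : ℝ) : u s = 0 := by
  obtain ⟨u', hu⟩ := hu
  suffices h : ∀ n s, coeff n (u s) = 0 by ext n; simpa using h n s
  intro n
  have hc : ∀ s, coeff n ((1 + X) * u' s) = -2 * (ρ * s) * coeff n ((1 - X) * u s) := fun s => by
    rw [(hu s).2, neg_two_mul_C, coeff_C_mul]
  induction n with
  | zero =>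
    refine scalar_eq_zero (ρ := ρ) (fun s => ((hu s).1 0).congr_deriv ?_) (by simp [h0])
    simpa [add_mul, sub_mul] using hc s
  | succ n ih =>
    have ih' : ∀ s, coeff n (u s) = 0 := by
      refine ih fun s => ?_
      rw [(hu s).2, neg_two_mul_C, coeff_C_mul]
    refine scalar_eq_zero (ρ := ρ) (fun s => ((hu s).1 (n + 1)).congr_deriv ?_) (by simp [h0])
    have h1 : coeff n (u' s) = 0 := by
      have := (hu s).1 n
      simp only [ih'] at this
      exact this.unique (hasDerivAt_const s 0)
    have := hc s
    simpa [add_mul, sub_mul, coeff_succ_X_mul, h1, ih' s] using this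

theorem eq_of_eq_zero (hu : IsRadialFlow ρ u) (hv : IsRadialFlow ρ v) (h0 : u 0 = v 0) (s : ℝ) :
    u s = v s :=
  sub_eq_zero.1 ((hu.sub hv).eq_zero (by simp [h0]) s)

end IsRadialFlow

/-- The generating function `∑ ψ_j(x)² X^j`. -/
noncomputable def oscSeries (x : ℝ) : ℝ⟦X⟧ := PowerSeries.mk fun j => oscPsi j x ^ 2

/-- Mehler's formula in differential form. Computing `(ψ_{n+1}²)'` by lowering and `(ψ_n²)'` by
raising, the cross terms `ψ_n ψ_{n+1}` cancel in the sum. -/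
theorem isRadialFlow_oscSeries : IsRadialFlow 1 oscSeries := by
  have hd : ∀ j x, HasDerivAt (fun x => oscPsi j x ^ 2)
      (2 * oscPsi j x * (x * oscPsi j x - √(2 * (j + 1)) * oscPsi (j + 1) x)) x := fun j x => by
    refine ((hasDerivAt_oscPsi j x).fun_pow 2).congr_deriv ?_
    norm_num
  refine ⟨fun x => PowerSeries.mk fun j =>
    2 * oscPsi j x * (x * oscPsi j x - √(2 * (j + 1)) * oscPsi (j + 1) x), fun x => ⟨fun n => by
      simpa [oscSeries] using hd n x, ?_⟩⟩
  rw [one_mul, neg_two_mul_C]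
  ext n
  rw [coeff_C_mul]
  cases n with
  | zero =>
    have := (hasDerivAt_oscPsi_zero x).unique (hasDerivAt_oscPsi 0 x)
    simp only [add_mul, sub_mul, one_mul, map_add, map_sub, coeff_zero_X_mul, oscSeries, coeff_mk]
    rw [← this]
    ring
  | succ n =>
    have := (hasDerivAt_oscPsi_succ n x).unique (hasDerivAt_oscPsi (n + 1) x)
    simp only [add_mul, sub_mul, one_mul, map_add, map_sub, coeff_succ_X_mul, oscSeries, coeff_mk]
    rw [← this]
    ring

/-- The generating function of the shell densities of the `(m + 1)`-dimensional oscillator at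
distance `r` from the origin. -/
noncomputable def shellSeries (m : ℕ) (r : ℝ) : ℝ⟦X⟧ := oscSeries r * oscSeries 0 ^ m

theorem isRadialFlow_shellSeries (m : ℕ) : IsRadialFlow 1 (shellSeries m) := by
  have := isRadialFlow_oscSeries.mul (IsRadialFlow.const (oscSeries 0 ^ m))
  rwa [add_zero] at this

/-- Along the ray `s ↦ s x` both sides are flows of rate `‖x‖²` with the same value at `s = 0`; the
identity is their equality at `s = 1`. -/
theorem prod_oscSeries {m : ℕ} (x : EuclideanSpace ℝ (Fin (m + 1))) :
    ∏ i, oscSeries (x i) = shellSeries m ‖x‖ := by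
  have h1 := IsRadialFlow.prod Finset.univ _ (fun i s => oscSeries (x i * s))
    fun i => isRadialFlow_oscSeries.comp_mul_left (x i)
  have h2 := (isRadialFlow_shellSeries m).comp_mul_left ‖x‖
  have h3 : ∑ i, 1 * x i ^ 2 = 1 * ‖x‖ ^ 2 := by
    simp [EuclideanSpace.norm_sq_eq]
  rw [h3] at h1
  simpa using h1.eq_of_eq_zero h2 (by simp [shellSeries, pow_succ']) 1

/-- The recurrence at the origin, as the equation satisfied by `(1 - X²)^(-1/2)`. -/
theorem derivative_oscSeries_zero :
    (1 - X ^ 2) * d⁄dX ℝ (oscSeries 0) = X * oscSeries 0 := by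
  ext n
  rcases n with _ | _ | n
  · rw [sub_mul, one_mul, pow_two, mul_assoc, map_sub, coeff_zero_X_mul, coeff_zero_X_mul,
      coeff_derivative, oscSeries, coeff_mk, oscPsi_one_zero]
    simp
  · have := oscPsi_succ_succ_zero_sq 0
    simp only [sub_mul, one_mul, pow_two, mul_assoc, map_sub, coeff_succ_X_mul, coeff_derivative,
      oscSeries, coeff_mk, coeff_zero_X_mul]
    push_cast at this ⊢
    linarith
  · have := oscPsi_succ_succ_zero_sq (n + 1)
    simp only [sub_mul, one_mul, pow_two, mul_assoc, map_sub, coeff_succ_X_mul, coeff_derivative,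
      oscSeries, coeff_mk]
    push_cast at this ⊢
    linarith

theorem derivative_oscSeries_zero_pow (d : ℕ) :
    (1 - X ^ 2) * d⁄dX ℝ (oscSeries 0 ^ d) = (d : ℝ⟦X⟧) * X * oscSeries 0 ^ d := by
  induction d with
  | zero => simp
  | succ d ih =>
    have := derivative_oscSeries_zero
    rw [pow_succ (oscSeries 0), Derivation.leibniz, smul_eq_mul, smul_eq_mul]
    push_cast
    linear_combination oscSeries 0 ^ d * this + oscSeries 0 * ih

/-- The Euler-type equation of the shell generating function in the formal variable. -/
theorem derivative_shellSeries (m : ℕ) (r : ℝ) :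
    (1 - X) * (1 + X) ^ 2 * d⁄dX ℝ (shellSeries m r)
      = (((m : ℝ⟦X⟧) + 1) * X * (1 + X) + 2 * PowerSeries.C (r ^ 2) * (1 - X)) *
        shellSeries m r := by
  obtain ⟨P', hP⟩ := isRadialFlow_shellSeries m
  -- The difference of the two sides is again a flow of rate `1`: the `r²` term is exactly what
  -- differentiating the exponential factor in `X` produces. Only `r = 0` then needs checking.
  have hflow : IsRadialFlow 1 fun r => (1 - X) * (1 + X) ^ 2 * d⁄dX ℝ (shellSeries m r)
      - (((m : ℝ⟦X⟧) + 1) * X * (1 + X) + 2 * PowerSeries.C (r ^ 2) * (1 - X)) *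
        shellSeries m r := by
    refine ⟨fun r => (1 - X) * (1 + X) ^ 2 * d⁄dX ℝ (P' r)
      - ((0 + 2 * PowerSeries.C (2 * r) * (1 - X)) * shellSeries m r +
        (((m : ℝ⟦X⟧) + 1) * X * (1 + X) + 2 * PowerSeries.C (r ^ 2) * (1 - X)) * P' r),
      fun r => ⟨?_, ?_⟩⟩
    · have h1 : HasCoeffDerivAt (fun r => PowerSeries.C (r ^ 2)) (PowerSeries.C (2 * r)) r :=
        HasCoeffDerivAt.C (by simpa using hasDerivAt_pow 2 r)
      have h2 := (HasCoeffDerivAt.const (((m : ℝ⟦X⟧) + 1) * X * (1 + X)) r).add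
        (h1.const_mul (2 * (1 - X)))
      refine (((hP r).1.derivative).const_mul _).sub ?_
      convert h2.mul (hP r).1 using 2
      · ring
      · ring
      · ring
    · have h1 := (hP r).2
      have h2 := congrArg (d⁄dX ℝ) h1
      rw [one_mul, neg_two_mul_C] at h2
      simp only [Derivation.leibniz, smul_eq_mul, map_add, map_sub, derivative_X,
        derivative_one, derivative_C] at h2
      simp only [map_mul, map_neg, map_pow, map_ofNat, one_mul] at h1 h2 ⊢
      linear_combination (1 - X) * (1 + X) ^ 2 * h2 - (1 - X) * (1 + X) * h1 -
        (((m : ℝ⟦X⟧) + 1) * X * (1 + X) + 2 * PowerSeries.C r ^ 2 * (1 - X)) * h1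
  have h0 := hflow.eq_zero ?_ r
  · exact sub_eq_zero.1 h0
  · have h := derivative_oscSeries_zero_pow (m + 1)
    have h' : shellSeries m 0 = oscSeries 0 ^ (m + 1) := by rw [shellSeries, pow_succ']
    push_cast at h
    simp only [h', ne_eq, OfNat.ofNat_ne_zero, not_false_eq_true, zero_pow, map_zero]
    linear_combination (1 + X) * h

end Flow

/-! ### The radial kernel and its differential identities -/

section Kernel

open PowerSeries

/-- The density of the `k`-th shell of the `(m + 1)`-dimensional oscillator at distance `r`. -/
noncomputable def shellDensity (m k : ℕ) (r : ℝ) : ℝ := coeff k (shellSeries m r)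

/-- The density of the first `n` shells of the `(m + 1)`-dimensional oscillator at distance `r`. -/
noncomputable def kernelSum (m n : ℕ) (r : ℝ) : ℝ := ∑ k ∈ Finset.range n, shellDensity m k r

/-- The coefficientwise derivative of `shellSeries`. -/
noncomputable def shellSeriesDeriv (m : ℕ) : ℝ → ℝ⟦X⟧ :=
  Classical.choose (isRadialFlow_shellSeries m)

theorem hasCoeffDerivAt_shellSeries (m : ℕ) (r : ℝ) :
    HasCoeffDerivAt (shellSeries m) (shellSeriesDeriv m r) r :=
  (Classical.choose_spec (isRadialFlow_shellSeries m) r).1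

theorem shellSeriesDeriv_eq (m : ℕ) (r : ℝ) :
    (1 + X) * shellSeriesDeriv m r = -2 * PowerSeries.C r * ((1 - X) * shellSeries m r) := by
  have := (Classical.choose_spec (isRadialFlow_shellSeries m) r).2
  rwa [one_mul] at this

/-- The derivative of `shellDensity`. -/
noncomputable def shellDensityDeriv (m k : ℕ) (r : ℝ) : ℝ := coeff k (shellSeriesDeriv m r)

/-- The derivative of `kernelSum`. -/
noncomputable def kernelSumDeriv (m n : ℕ) (r : ℝ) : ℝ :=
  ∑ k ∈ Finset.range n, shellDensityDeriv m k r

theorem hasDerivAt_shellDensity (m k : ℕ) (r : ℝ) :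
    HasDerivAt (shellDensity m k) (shellDensityDeriv m k r) r :=
  hasCoeffDerivAt_shellSeries m r k

theorem hasDerivAt_kernelSum (m n : ℕ) (r : ℝ) :
    HasDerivAt (kernelSum m n) (kernelSumDeriv m n r) r :=
  HasDerivAt.fun_sum fun k _ => hasDerivAt_shellDensity m k r

theorem kernelSum_succ (m n : ℕ) (r : ℝ) :
    kernelSum m (n + 1) r = kernelSum m n r + shellDensity m n r :=
  Finset.sum_range_succ _ _

theorem kernelSumDeriv_succ (m n : ℕ) (r : ℝ) :
    kernelSumDeriv m (n + 1) r = kernelSumDeriv m n r + shellDensityDeriv m n r :=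
  Finset.sum_range_succ _ _

theorem coeff_mul_mk_one (f : ℝ⟦X⟧) (n : ℕ) :
    coeff n (f * PowerSeries.mk 1) = ∑ k ∈ Finset.range (n + 1), coeff k f := by
  rw [coeff_mul, Finset.Nat.sum_antidiagonal_eq_sum_range_succ_mk]
  simp

theorem coeff_oscSeries_pow_nonneg (m k : ℕ) : 0 ≤ coeff k (oscSeries 0 ^ m) := by
  induction m generalizing k with
  | zero =>
    rw [pow_zero, coeff_one]
    split_ifs <;> norm_num
  | succ m ih =>
    rw [pow_succ, coeff_mul]
    exact Finset.sum_nonneg fun p _ => mul_nonneg (ih _) (by simpa [oscSeries] using sq_nonneg _)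

theorem shellDensity_nonneg (m k : ℕ) (r : ℝ) : 0 ≤ shellDensity m k r := by
  rw [shellDensity, shellSeries, coeff_mul]
  exact Finset.sum_nonneg fun p _ => mul_nonneg (by simpa [oscSeries] using sq_nonneg _)
    (coeff_oscSeries_pow_nonneg _ _)

theorem kernelSum_nonneg (m n : ℕ) (r : ℝ) : 0 ≤ kernelSum m n r :=
  Finset.sum_nonneg fun k _ => shellDensity_nonneg m k r

theorem kernelSum_mono (m : ℕ) (r : ℝ) {n n' : ℕ} (h : n ≤ n') :
    kernelSum m n r ≤ kernelSum m n' r :=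
  Finset.sum_le_sum_of_subset_of_nonneg (Finset.range_subset_range.2 h)
    fun k _ _ => shellDensity_nonneg m k r

theorem shellDensityDeriv_zero (m : ℕ) (r : ℝ) :
    shellDensityDeriv m 0 r = -2 * r * shellDensity m 0 r := by
  have := congrArg (coeff 0) (shellSeriesDeriv_eq m r)
  rw [neg_two_mul_C, coeff_C_mul] at this
  simp only [add_mul, sub_mul, one_mul, map_add, map_sub, coeff_zero_X_mul, add_zero, sub_zero]
    at this
  exact this

theorem shellDensityDeriv_succ (m k : ℕ) (r : ℝ) :
    shellDensityDeriv m (k + 1) r + shellDensityDeriv m k r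
      = -2 * r * (shellDensity m (k + 1) r - shellDensity m k r) := by
  have := congrArg (coeff (k + 1)) (shellSeriesDeriv_eq m r)
  rw [neg_two_mul_C, coeff_C_mul] at this
  simp only [add_mul, sub_mul, one_mul, map_add, map_sub, coeff_succ_X_mul] at this
  exact this

/-- Summing over shells divides the generating function by `1 - X`, which cancels the factor `1 - X`
of the flow equation. The resulting sign drives both the uniform bound and the exponential decay. -/
theorem kernelSumDeriv_add_succ (m n : ℕ) (r : ℝ) :
    kernelSumDeriv m n r + kernelSumDeriv m (n + 1) r = -2 * r * shellDensity m n r := by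
  induction n with
  | zero => simp [kernelSumDeriv, shellDensityDeriv_zero]
  | succ n ih =>
    have h1 := kernelSumDeriv_succ m n r
    have h2 := kernelSumDeriv_succ m (n + 1) r
    have h3 := shellDensityDeriv_succ m n r
    linarith

/-- The kernel of the fermionic process is a radial function. -/
theorem fermiKernel_self {m : ℕ} (n : ℕ) (x : EuclideanSpace ℝ (Fin (m + 1))) :
    fermiKernel n x x = kernelSum m n ‖x‖ := by
  rw [fermiKernel, kernelSum]
  have h : ∀ j ∈ multiIdxLT (m + 1) n, ∑ k, j k ∈ Finset.range n := fun j hj => by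
    simpa using (mem_multiIdxLT j).1 hj
  -- Multi-indices are grouped by their sum `k`; each group is the `k`-th coefficient of the product
  -- of one-dimensional series.
  rw [← Finset.sum_fiberwise_of_maps_to h]
  refine Finset.sum_congr rfl fun k hk => ?_
  rw [shellDensity, ← prod_oscSeries, coeff_prod]
  symm
  refine Finset.sum_bij' (fun l _ => l) (fun j _ => Finsupp.equivFunOnFinite.symm j) ?_ ?_ ?_ ?_ ?_
  · intro l hl
    rw [Finset.mem_finsuppAntidiag] at hl
    rw [Finset.mem_filter, mem_multiIdxLT]
    exact ⟨by rw [hl.1]; exact Finset.mem_range.1 hk, hl.1⟩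
  · intro j hj
    rw [Finset.mem_finsuppAntidiag]
    exact ⟨(Finset.mem_filter.1 hj).2, Finset.subset_univ _⟩
  · intro l _
    simp
  · intro j _
    simp
  · intro l _
    rw [oscPsiProd, ← Finset.prod_mul_distrib]
    exact Finset.prod_congr rfl fun i _ => by rw [oscSeries, coeff_mk, pow_two]

theorem scaledFermiKernel_self {m : ℕ} (n : ℕ) (x : EuclideanSpace ℝ (Fin (m + 1))) :
    scaledFermiKernel n x x
      = (n : ℝ) ^ (((m + 1 : ℕ) : ℝ) / 2) * kernelSum m n (√n * ‖x‖) := by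
  rw [scaledFermiKernel, fermiKernel_self, norm_smul, Real.norm_of_nonneg (Real.sqrt_nonneg _)]

/-- The primitive of `(2 n - r²) K_n' + d r K_n`, up to a constant, where `d = m + 1` and the index
is shifted by one. -/
noncomputable def kernelPotential (m n : ℕ) (r : ℝ) : ℝ :=
  -((n + 1) * shellDensity m (n + 1) r - n * shellDensity m n r) / 2
    + (m + 1) / 2 * shellDensity m n r - m * kernelSum m (n + 1) r

/-- With `F = P / (1 - X)` generating the kernels, the flow equation, its `X`-derivative and the
equation of `P` in `X` reduce everything to multiples of `P`. The coefficient of `X^n` in `F` is the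
kernel of index `n + 1`, hence the shift. -/
theorem hasDerivAt_kernelPotential (m n : ℕ) (r : ℝ) :
    HasDerivAt (kernelPotential m n)
      ((2 * (n + 1) - r ^ 2) * kernelSumDeriv m (n + 1) r + (m + 1) * r * kernelSum m (n + 1) r)
      r := by
  have h1 := (hasDerivAt_shellDensity m (n + 1) r).const_mul ((n : ℝ) + 1)
  have h2 := (hasDerivAt_shellDensity m n r).const_mul (n : ℝ)
  have h3 := (hasDerivAt_shellDensity m n r).const_mul (((m : ℝ) + 1) / 2)
  have h4 := (hasDerivAt_kernelSum m (n + 1) r).const_mul (m : ℝ)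
  refine HasDerivAt.congr_deriv (f := kernelPotential m n)
    ((((h1.sub h2).neg.div_const 2).add h3).sub h4) ?_
  set P := shellSeries m r with hP
  set P' := shellSeriesDeriv m r with hP'
  set F := P * PowerSeries.mk 1 with hF
  set F' := P' * PowerSeries.mk 1 with hF'
  have hcF : coeff n F = kernelSum m (n + 1) r := coeff_mul_mk_one _ _
  have hcF' : coeff n F' = kernelSumDeriv m (n + 1) r := coeff_mul_mk_one _ _
  have e1 := shellSeriesDeriv_eq m r
  have e3 := derivative_shellSeries m r
  rw [← hP, ← hP'] at e1
  rw [← hP] at e3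
  have e2 := congrArg (d⁄dX ℝ) e1
  rw [neg_two_mul_C] at e2
  have hone : (PowerSeries.mk 1 : ℝ⟦X⟧) * (1 - X) = 1 := PowerSeries.mk_one_mul_one_sub_eq_one ℝ
  have e4 : (1 - X) * F = P := by rw [hF]; linear_combination P * hone
  have e5 : (1 - X) * F' = P' := by rw [hF']; linear_combination P' * hone
  have e6 := congrArg (d⁄dX ℝ) e5
  simp only [Derivation.leibniz, smul_eq_mul, map_add, map_sub, derivative_X,
    derivative_one, derivative_C] at e2 e6
  -- Twice the claim for all `n` at once. Cancelling `(1 - X)² (1 + X)³`, a nonzero element of a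
  -- domain, clears all denominators.
  have key : 2 * (2 * (X * d⁄dX ℝ F') + 2 * F' - PowerSeries.C (r ^ 2) * F'
      + PowerSeries.C ((m + 1) * r) * F)
      = -((1 - X) * d⁄dX ℝ P') + PowerSeries.C ((m : ℝ) + 1) * P'
        - 2 * (PowerSeries.C (m : ℝ) * F') := by
    have hne : ((1 - X) ^ 2 * (1 + X) ^ 3 : ℝ⟦X⟧) ≠ 0 := by
      refine mul_ne_zero (pow_ne_zero _ ?_) (pow_ne_zero _ ?_)
      · intro h; simpa using congrArg constantCoeff h
      · intro h; simpa using congrArg constantCoeff h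
    refine mul_left_cancel₀ hne ?_
    simp only [map_mul, map_neg, map_pow, map_ofNat, map_add, map_one, map_natCast] at e1 e2 e3 ⊢
    linear_combination 2 * (e6 * 2 * X * (1 - X) * (1 + X) ^ 3
      + e5 * ((((m : ℝ⟦X⟧) + 2) - PowerSeries.C r ^ 2) * (1 - X) * (1 + X) ^ 3
          + 2 * X * (1 + X) ^ 3)
      + e4 * ((m : ℝ⟦X⟧) + 1) * PowerSeries.C r * (1 - X) * (1 + X) ^ 3)
      + e2 * (4 * X * (1 - X) * (1 + X) ^ 2 + (1 - X) ^ 3 * (1 + X) ^ 2)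
      + e1 * (2 * ((((m : ℝ⟦X⟧) + 2) - PowerSeries.C r ^ 2) * (1 - X) * (1 + X) ^ 2
          + 2 * X * (1 + X) ^ 2) - ((m : ℝ⟦X⟧) + 1) * (1 - X) ^ 2 * (1 + X) ^ 2
          - 4 * X * (1 - X) * (1 + X) - (1 - X) ^ 3 * (1 + X))
      - e3 * (2 * PowerSeries.C r * (4 * X * (1 - X) + (1 - X) ^ 3))
  have kc := congrArg (coeff n) key
  have hXd : ∀ f : ℝ⟦X⟧, coeff n (X * d⁄dX ℝ f) = n * coeff n f := fun f => by
    cases n with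
    | zero => simp
    | succ n => rw [coeff_succ_X_mul, coeff_derivative]; push_cast; ring
  have h2C : ∀ f : ℝ⟦X⟧, coeff n (2 * f) = 2 * coeff n f := fun f => by
    rw [← map_ofNat PowerSeries.C 2, coeff_C_mul]
  simp only [h2C, map_add, map_sub, map_neg, sub_mul, one_mul, hXd, hcF', coeff_derivative]
    at kc
  rw [← map_add (M := ℝ), coeff_C_mul, coeff_C_mul, coeff_C_mul, coeff_C_mul] at kc
  simp only [hcF, hcF'] at kc
  change 2 * (2 * (n * kernelSumDeriv m (n + 1) r) + 2 * kernelSumDeriv m (n + 1) r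
    - r ^ 2 * kernelSumDeriv m (n + 1) r + (m + 1) * r * kernelSum m (n + 1) r)
    = -(shellDensityDeriv m (n + 1) r * (n + 1) - n * shellDensityDeriv m n r)
      + (m + 1) * shellDensityDeriv m n r - 2 * (m * kernelSumDeriv m (n + 1) r) at kc
  linarith

end Kernel

/-! ### Exact value at the origin -/

section Origin

open PowerSeries

theorem coeff_oscSeries_zero_pow_add_two (d k : ℕ) :
    ((k : ℝ) + 2) * coeff (k + 2) (oscSeries 0 ^ d) = (k + d) * coeff k (oscSeries 0 ^ d) := by
  have h := congrArg (coeff (k + 1)) (derivative_oscSeries_zero_pow d)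
  rw [mul_assoc, ← map_natCast PowerSeries.C d, coeff_C_mul, coeff_succ_X_mul] at h
  cases k with
  | zero =>
    simp only [sub_mul, one_mul, pow_two, mul_assoc, map_sub, coeff_succ_X_mul, coeff_derivative,
      coeff_zero_X_mul] at h
    push_cast at h ⊢
    linarith
  | succ k =>
    simp only [sub_mul, one_mul, pow_two, mul_assoc, map_sub, coeff_succ_X_mul, coeff_derivative]
      at h
    push_cast at h ⊢
    linarith

theorem coeff_zero_oscSeries_zero_pow (d : ℕ) :
    coeff 0 (oscSeries 0 ^ d) = (1 / √π) ^ d := by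
  rw [coeff_zero_eq_constantCoeff_apply, map_pow, ← coeff_zero_eq_constantCoeff_apply, oscSeries,
    coeff_mk, oscPsi_zero_zero_sq]

theorem coeff_odd_oscSeries_zero_pow (d k : ℕ) : coeff (2 * k + 1) (oscSeries 0 ^ d) = 0 := by
  induction k with
  | zero =>
    have h := congrArg (coeff 0) (derivative_oscSeries_zero_pow d)
    rw [mul_assoc, ← map_natCast PowerSeries.C d, coeff_C_mul, coeff_zero_X_mul, sub_mul, one_mul,
      pow_two, mul_assoc, map_sub, coeff_zero_X_mul, coeff_derivative] at h
    simpa using h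
  | succ k ih =>
    have h := coeff_oscSeries_zero_pow_add_two d (2 * k + 1)
    rw [ih, mul_zero] at h
    exact (mul_eq_zero.1 h).resolve_left (by positivity)

theorem sum_coeff_oscSeries_zero_pow (d N : ℕ) :
    ∑ k ∈ Finset.range (2 * N + 1), coeff k (oscSeries 0 ^ d)
      = (1 / √π) ^ d / Gamma ((d : ℝ) / 2 + 1) * (Gamma (N + 1 + (d : ℝ) / 2) / N !) := by
  have hG : Gamma ((d : ℝ) / 2 + 1) ≠ 0 := (Gamma_pos_of_pos (by positivity)).ne'
  -- The induction is closed by carrying along the next even coefficient as a multiple of the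
  -- partial sum.
  suffices h : ∑ k ∈ Finset.range (2 * N + 1), coeff k (oscSeries 0 ^ d)
      = (1 / √π) ^ d / Gamma ((d : ℝ) / 2 + 1) * (Gamma (N + 1 + (d : ℝ) / 2) / N !) ∧
      ((N : ℝ) + 1) * coeff (2 * N + 2) (oscSeries 0 ^ d) = (d : ℝ) / 2 *
        ((1 / √π) ^ d / Gamma ((d : ℝ) / 2 + 1) * (Gamma (N + 1 + (d : ℝ) / 2) / N !)) from h.1
  induction N with
  | zero =>
    have h := coeff_oscSeries_zero_pow_add_two d 0
    have h0 := coeff_zero_oscSeries_zero_pow d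
    have h1 : (1 / √π) ^ d / Gamma ((d : ℝ) / 2 + 1) *
        (Gamma (((0 : ℕ) : ℝ) + 1 + (d : ℝ) / 2) / (0 ! : ℕ)) = (1 / √π) ^ d := by
      rw [Nat.factorial_zero, Nat.cast_zero, Nat.cast_one, zero_add, add_comm 1]
      field_simp
    rw [h1, mul_zero, zero_add, Finset.sum_range_one, h0]
    refine ⟨rfl, ?_⟩
    rw [h0] at h
    push_cast at h ⊢
    linarith
  | succ N ih =>
    have hr : (1 / √π) ^ d / Gamma ((d : ℝ) / 2 + 1) *
        (Gamma (((N + 1 : ℕ) : ℝ) + 1 + (d : ℝ) / 2) / ((N + 1)! : ℕ))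
        = ((N : ℝ) + 1 + (d : ℝ) / 2) / (N + 1) * ((1 / √π) ^ d / Gamma ((d : ℝ) / 2 + 1) *
        (Gamma (N + 1 + (d : ℝ) / 2) / N !)) := by
      rw [Nat.factorial_succ]
      push_cast
      rw [show (N : ℝ) + 1 + 1 + d / 2 = (N + 1 + d / 2) + 1 by ring,
        Gamma_add_one (s := (N : ℝ) + 1 + d / 2) (by positivity)]
      have : (N ! : ℝ) ≠ 0 := by positivity
      generalize Gamma ((d : ℝ) / 2 + 1) = g at *
      generalize Gamma ((N : ℝ) + 1 + (d : ℝ) / 2) = g'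
      field_simp
    rw [hr]
    set c := (1 / √π) ^ d / Gamma ((d : ℝ) / 2 + 1) * (Gamma (N + 1 + (d : ℝ) / 2) / N !)
    have hb : coeff (2 * N + 2) (oscSeries 0 ^ d) = (d : ℝ) / 2 * c / (N + 1) := by
      rw [eq_div_iff (by positivity)]; linarith [ih.2]
    constructor
    · rw [show 2 * (N + 1) + 1 = 2 * N + 1 + 1 + 1 by ring, Finset.sum_range_succ,
        Finset.sum_range_succ, ih.1, coeff_odd_oscSeries_zero_pow, hb]
      field_simp
      ring
    · have h := coeff_oscSeries_zero_pow_add_two d (2 * N + 2)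
      rw [hb] at h
      rw [show 2 * (N + 1) + 2 = 2 * N + 2 + 2 by ring]
      push_cast at h ⊢
      have h2 : ((N : ℝ) + 1 + 1) * coeff (2 * N + 2 + 2) (oscSeries 0 ^ d)
          = (N + 1 + d / 2) * ((d : ℝ) / 2 * c / (N + 1)) := by linarith
      rw [h2]
      ring

/-- The kernel at the origin, in closed form. -/
theorem kernelSum_zero (m n : ℕ) :
    kernelSum m (n + 1) 0 = (1 / √π) ^ (m + 1) / Gamma (((m + 1 : ℕ) : ℝ) / 2 + 1) *
      (Gamma ((n / 2 : ℕ) + 1 + ((m + 1 : ℕ) : ℝ) / 2) / (n / 2)!) := by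
  rw [← sum_coeff_oscSeries_zero_pow (m + 1) (n / 2)]
  have h : kernelSum m (n + 1) 0 = ∑ k ∈ Finset.range (n + 1), coeff k (oscSeries 0 ^ (m + 1)) := by
    simp only [kernelSum, shellDensity, shellSeries, pow_succ']
  rw [h]
  rcases Nat.even_or_odd' n with ⟨k, rfl | rfl⟩
  · rw [show 2 * k / 2 = k by omega]
  · rw [show (2 * k + 1) / 2 = k by omega, Finset.sum_range_succ, coeff_odd_oscSeries_zero_pow,
      add_zero]

end Origin

/-! ### Gamma quotients and asymptotics at the origin -/

theorem Gamma_half_quotient_sq_bounds (N : ℕ) :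
    (N : ℝ) + 1 / 2 ≤ (Gamma (N + 1 + 1 / 2) / N !) ^ 2 ∧
      (Gamma (N + 1 + 1 / 2) / N !) ^ 2 ≤ (N : ℝ) + 1 := by
  have hf : (0 : ℝ) < N ! := by positivity
  have hG : (0 : ℝ) < Gamma (N + 1 + 1 / 2) := Gamma_pos_of_pos (by positivity)
  -- Log-convexity of Gamma at a midpoint; it is applied around `N + 1` and around `N + 3/2`.
  have hsq : ∀ s t : ℝ, 0 < s → 0 < t → Gamma (1 / 2 * s + 1 / 2 * t) ^ 2 ≤ Gamma s * Gamma t := by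
    intro s t hs ht
    have h := Gamma_mul_add_mul_le_rpow_Gamma_mul_rpow_Gamma hs ht
      (a := 1 / 2) (b := 1 / 2) (by norm_num) (by norm_num) (by norm_num)
    have h0 : 0 ≤ Gamma (1 / 2 * s + 1 / 2 * t) := (Gamma_pos_of_pos (by positivity)).le
    calc Gamma (1 / 2 * s + 1 / 2 * t) ^ 2
        ≤ (Gamma s ^ (1 / 2 : ℝ) * Gamma t ^ (1 / 2 : ℝ)) ^ 2 := pow_le_pow_left₀ h0 h 2
      _ = Gamma s * Gamma t := by
        rw [← Real.sqrt_eq_rpow, ← Real.sqrt_eq_rpow, mul_pow,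
          Real.sq_sqrt (Gamma_pos_of_pos hs).le, Real.sq_sqrt (Gamma_pos_of_pos ht).le]
  rw [div_pow, le_div_iff₀ (by positivity), div_le_iff₀ (by positivity)]
  constructor
  · have h := hsq (N + 1 / 2) (N + 1 + 1 / 2) (by positivity) (by positivity)
    rw [show 1 / 2 * ((N : ℝ) + 1 / 2) + 1 / 2 * (N + 1 + 1 / 2) = N + 1 by ring,
      Gamma_nat_eq_factorial] at h
    have h2 : Gamma ((N : ℝ) + 1 + 1 / 2) = (N + 1 / 2) * Gamma (N + 1 / 2) := by
      rw [← Gamma_add_one (by positivity)]; congr 1; ring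
    have h3 : (0 : ℝ) ≤ N + 1 / 2 := by positivity
    calc ((N : ℝ) + 1 / 2) * (N ! : ℝ) ^ 2
        ≤ (N + 1 / 2) * (Gamma (N + 1 / 2) * Gamma (N + 1 + 1 / 2)) :=
          mul_le_mul_of_nonneg_left h h3
      _ = Gamma (N + 1 + 1 / 2) ^ 2 := by rw [pow_two]; nth_rewrite 2 [h2]; ring
  · have h := hsq (N + 1) (N + 1 + 1) (by positivity) (by positivity)
    rw [show 1 / 2 * ((N : ℝ) + 1) + 1 / 2 * (N + 1 + 1) = N + 1 + 1 / 2 by ring,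
      Gamma_add_one (s := (N : ℝ) + 1) (by positivity), Gamma_nat_eq_factorial] at h
    linarith

/-- `Γ(N + 1 + d/2) / N! = y ^ (d/2) (1 + O(1/y))` for `N + 1/2 ≤ y ≤ N + 1`. -/
theorem exists_abs_Gamma_quotient_sub_rpow_le (d : ℕ) :
    ∃ C : ℝ, 0 ≤ C ∧ ∀ (N : ℕ) (y : ℝ), (N : ℝ) + 1 / 2 ≤ y → y ≤ N + 1 →
      |Gamma (N + 1 + (d : ℝ) / 2) / (N ! : ℝ) - y ^ ((d : ℝ) / 2)| ≤ C * y ^ ((d : ℝ) / 2 - 1) := by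
  -- Passing from `d` to `d + 2` multiplies the quotient by `N + 1 + d/2`, which is `y + O(1)`.
  induction d using Nat.twoStepInduction with
  | zero =>
    refine ⟨0, le_rfl, fun N y _ _ => ?_⟩
    have hf : (N ! : ℝ) ≠ 0 := by positivity
    simp [Gamma_nat_eq_factorial, hf]
  | one =>
    refine ⟨1, zero_le_one, fun N y h1 h2 => ?_⟩
    have hy : 0 < y := lt_of_lt_of_le (by positivity) h1
    obtain ⟨h3, h4⟩ := Gamma_half_quotient_sq_bounds N
    have hG : 0 ≤ Gamma (N + 1 + 1 / 2) / N ! :=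
      div_nonneg (Gamma_pos_of_pos (by positivity)).le (by positivity)
    push_cast
    set G := Gamma (N + 1 + 1 / 2) / (N ! : ℝ)
    have hs : 0 < √y := Real.sqrt_pos.2 hy
    have hs2 : √y ^ 2 = y := Real.sq_sqrt hy.le
    rw [Real.rpow_sub hy, ← Real.sqrt_eq_rpow, Real.rpow_one, one_mul]
    have h5 : |G - √y| * √y ≤ 1 := by
      calc |G - √y| * √y ≤ |G - √y| * (G + √y) := by gcongr; linarith
        _ = |G ^ 2 - y| := by
          rw [show G ^ 2 - y = (G - √y) * (G + √y) by linear_combination hs2, abs_mul,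
            abs_of_nonneg (by positivity : 0 ≤ G + √y)]
        _ ≤ 1 := abs_le.2 ⟨by linarith, by linarith⟩
    rw [le_div_iff₀ hy]
    calc |G - √y| * y = |G - √y| * √y * √y := by rw [mul_assoc, ← pow_two, hs2]
      _ ≤ 1 * √y := by gcongr
      _ = √y := one_mul _
  | more d ih _ =>
    obtain ⟨C, hC, ih⟩ := ih
    refine ⟨((d : ℝ) / 2 + 1) * (1 + 2 * C) + C, by positivity, fun N y h1 h2 => ?_⟩
    have hy : 0 < y := lt_of_lt_of_le (by positivity) h1
    have hy2 : 1 / 2 ≤ y := le_trans (by linarith [(Nat.cast_nonneg N : (0 : ℝ) ≤ N)]) h1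
    have hi := ih N y h1 h2
    push_cast
    rw [show (N : ℝ) + 1 + (d + 2) / 2 = (N + 1 + d / 2) + 1 by ring,
      Gamma_add_one (s := (N : ℝ) + 1 + d / 2) (by positivity), mul_div_assoc,
      show ((d : ℝ) + 2) / 2 = d / 2 + 1 by ring, Real.rpow_add_one hy.ne', add_sub_cancel_right]
    set G := Gamma (N + 1 + (d : ℝ) / 2) / (N ! : ℝ)
    rw [Real.rpow_sub_one hy.ne'] at hi
    set Y := y ^ ((d : ℝ) / 2)
    have hY : 0 < Y := Real.rpow_pos_of_pos hy _
    have h3 : |G - Y| ≤ 2 * C * Y := hi.trans (by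
      rw [← mul_div_assoc, div_le_iff₀ hy]; nlinarith [mul_nonneg hC hY.le])
    have h4 : |G| ≤ (1 + 2 * C) * Y := by
      calc |G| = |(G - Y) + Y| := by ring_nf
        _ ≤ |G - Y| + |Y| := abs_add_le _ _
        _ ≤ (1 + 2 * C) * Y := by rw [abs_of_pos hY]; linarith
    have h5 : |(N : ℝ) + 1 + d / 2 - y| ≤ d / 2 + 1 :=
      abs_le.2 ⟨by linarith [(Nat.cast_nonneg d : (0 : ℝ) ≤ d)], by linarith⟩
    have h6 : |G - Y| * y ≤ C * Y := by
      have := mul_le_mul_of_nonneg_right hi hy.le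
      calc |G - Y| * y ≤ C * (Y / y) * y := this
        _ = C * Y := by field_simp
    calc |((N : ℝ) + 1 + d / 2) * G - Y * y|
        = |((N : ℝ) + 1 + d / 2 - y) * G + (G - Y) * y| := by ring_nf
      _ ≤ |(N : ℝ) + 1 + d / 2 - y| * |G| + |G - Y| * y := by
        refine (abs_add_le _ _).trans ?_
        rw [abs_mul, abs_mul, abs_of_pos hy]
      _ ≤ ((d : ℝ) / 2 + 1) * ((1 + 2 * C) * Y) + C * Y := by gcongr
      _ = _ := by ring

/-- The leading constant of the density at the origin, in dimension `d`. -/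
noncomputable def originConst (d : ℕ) : ℝ := (1 / √π) ^ d / Gamma ((d : ℝ) / 2 + 1)

theorem originConst_pos (d : ℕ) : 0 < originConst d :=
  div_pos (pow_pos (by positivity) _) (Gamma_pos_of_pos (by positivity))

theorem exists_abs_kernelSum_zero_sub_le (m : ℕ) :
    ∃ C : ℝ, 0 ≤ C ∧ ∀ n : ℕ, 1 ≤ n →
      |kernelSum m n 0 - originConst (m + 1) * ((n : ℝ) / 2) ^ (((m + 1 : ℕ) : ℝ) / 2)|
        ≤ C * ((n : ℝ) / 2) ^ (((m + 1 : ℕ) : ℝ) / 2 - 1) := by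
  obtain ⟨C, hC, h⟩ := exists_abs_Gamma_quotient_sub_rpow_le (m + 1)
  refine ⟨originConst (m + 1) * C, mul_nonneg (originConst_pos _).le hC, fun n hn => ?_⟩
  obtain ⟨n, rfl⟩ := Nat.exists_eq_add_of_le' hn
  -- For either parity of `n`, `(n + 1)/2` lies between `⌊n/2⌋ + 1/2` and `⌊n/2⌋ + 1`.
  have h1 := h (n / 2) (((n + 1 : ℕ) : ℝ) / 2) ?_ ?_
  · rw [kernelSum_zero]
    change |originConst (m + 1) * _ - _| ≤ _
    rw [← mul_sub, abs_mul, abs_of_pos (originConst_pos _), mul_assoc]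
    exact mul_le_mul_of_nonneg_left h1 (originConst_pos _).le
  · have : 2 * (n / 2) + 1 ≤ n + 1 := by omega
    have : (2 : ℝ) * (n / 2 : ℕ) + 1 ≤ (n + 1 : ℕ) := by exact_mod_cast this
    linarith
  · have : n + 1 ≤ 2 * (n / 2) + 2 := by omega
    have : ((n + 1 : ℕ) : ℝ) ≤ 2 * (n / 2 : ℕ) + 2 := by exact_mod_cast this
    linarith

theorem exists_kernelSum_zero_le (m : ℕ) :
    ∃ C : ℝ, 0 < C ∧ ∀ n : ℕ, 1 ≤ n →
      kernelSum m n 0 ≤ C * (n : ℝ) ^ (((m + 1 : ℕ) : ℝ) / 2) := by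
  obtain ⟨C, hC, h⟩ := exists_abs_kernelSum_zero_sub_le m
  refine ⟨originConst (m + 1) + 2 * C, add_pos_of_pos_of_nonneg (originConst_pos _) (by positivity),
    fun n hn => ?_⟩
  have hn' : (1 : ℝ) ≤ n := by exact_mod_cast hn
  have hn2 : (0 : ℝ) < (n : ℝ) / 2 := by positivity
  have h1 := (abs_le.1 (h n hn)).2
  rw [Real.rpow_sub_one hn2.ne'] at h1
  have h2 : ((n : ℝ) / 2) ^ (((m + 1 : ℕ) : ℝ) / 2) ≤ (n : ℝ) ^ (((m + 1 : ℕ) : ℝ) / 2) :=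
    Real.rpow_le_rpow hn2.le (by linarith) (by positivity)
  set Y := ((n : ℝ) / 2) ^ (((m + 1 : ℕ) : ℝ) / 2)
  have hY : 0 < Y := Real.rpow_pos_of_pos hn2 _
  have h3 : Y / ((n : ℝ) / 2) ≤ 2 * Y := by
    rw [div_le_iff₀ hn2]; nlinarith
  have h4 : kernelSum m n 0 ≤ (originConst (m + 1) + 2 * C) * Y := by
    nlinarith [mul_le_mul_of_nonneg_left h3 hC]
  exact h4.trans (mul_le_mul_of_nonneg_left h2
    (add_nonneg (originConst_pos _).le (by positivity)))

/-! ### Upper bounds for the kernel and the shell densities -/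

section Bounds

open PowerSeries

theorem le_apply_zero_of_hasDerivAt_nonpos {f f' : ℝ → ℝ} (hf : ∀ x, HasDerivAt f (f' x) x)
    (h : ∀ x, 0 ≤ x → f' x ≤ 0) {r : ℝ} (hr : 0 ≤ r) : f r ≤ f 0 := by
  refine antitoneOn_of_deriv_nonpos (convex_Ici 0)
    (fun x _ => (hf x).continuousAt.continuousWithinAt)
    (fun x _ => (hf x).differentiableAt.differentiableWithinAt) (fun x hx => ?_)
    Set.self_mem_Ici hr hr
  rw [(hf x).deriv]
  exact h x (interior_subset hx)

/-- `K_n` itself need not be monotone, but `K_n + K_{n+1}` decreases on `[0, ∞)`, so the values at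
the origin dominate. -/
theorem exists_kernelSum_le (m : ℕ) :
    ∃ C : ℝ, 0 < C ∧ ∀ n : ℕ, 1 ≤ n → ∀ r : ℝ, 0 ≤ r →
      kernelSum m n r ≤ C * (n : ℝ) ^ (((m + 1 : ℕ) : ℝ) / 2) := by
  obtain ⟨C, hC, h⟩ := exists_kernelSum_zero_le m
  refine ⟨2 * C * 2 ^ (((m + 1 : ℕ) : ℝ) / 2), by positivity, fun n hn r hr => ?_⟩
  have hn' : (1 : ℝ) ≤ n := by exact_mod_cast hn
  have h1 := le_apply_zero_of_hasDerivAt_nonpos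
    (fun x => (hasDerivAt_kernelSum m n x).fun_add (hasDerivAt_kernelSum m (n + 1) x))
    (fun x hx => by
      rw [kernelSumDeriv_add_succ]
      nlinarith [mul_nonneg hx (shellDensity_nonneg m n x)]) hr
  have h2 := kernelSum_nonneg m (n + 1) r
  have h3 := kernelSum_mono m 0 (Nat.le_succ n)
  have h4 := h (n + 1) (by omega)
  have h5 : ((n + 1 : ℕ) : ℝ) ^ (((m + 1 : ℕ) : ℝ) / 2)
      ≤ 2 ^ (((m + 1 : ℕ) : ℝ) / 2) * (n : ℝ) ^ (((m + 1 : ℕ) : ℝ) / 2) := by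
    rw [← Real.mul_rpow (by norm_num) (by positivity)]
    exact Real.rpow_le_rpow (by positivity) (by push_cast; linarith) (by positivity)
  have h6 := mul_le_mul_of_nonneg_left h5 hC.le
  simp only [Nat.succ_eq_add_one] at h3
  nlinarith

/-- The step from `j` to `j + 2` multiplies the left side by `(j + 1)(j + 3)/(j + 2)² ≤ 1`. -/
theorem succ_mul_oscPsi_zero_sq_sq_le (j : ℕ) : ((j : ℝ) + 1) * (oscPsi j 0 ^ 2) ^ 2 ≤ 1 := by
  induction j using Nat.twoStepInduction with
  | zero =>
    have h : 1 ≤ √π := Real.one_le_sqrt.2 (by linarith [Real.pi_gt_three])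
    have h2 : 1 / √π ≤ 1 := by rw [div_le_one (by positivity)]; exact h
    rw [oscPsi_zero_zero_sq]
    have h3 : 0 ≤ 1 / √π := by positivity
    push_cast
    nlinarith
  | one => simp [oscPsi_one_zero]
  | more j ih _ =>
    have h := oscPsi_succ_succ_zero_sq j
    have h1 : oscPsi (j + 2) 0 ^ 2 = (j + 1) / (j + 2) * oscPsi j 0 ^ 2 := by
      field_simp; linarith
    rw [h1, mul_pow]
    push_cast
    refine le_trans ?_ ih
    rw [← mul_assoc]
    refine mul_le_mul_of_nonneg_right ?_ (by positivity)
    rw [div_pow, ← mul_div_assoc, div_le_iff₀ (by positivity)]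
    nlinarith [(Nat.cast_nonneg j : (0 : ℝ) ≤ j)]

theorem oscPsi_zero_sq_le (j : ℕ) : oscPsi j 0 ^ 2 ≤ 1 / √((j : ℝ) + 1) := by
  have h := Real.le_sqrt_of_sq_le (x := √((j : ℝ) + 1) * oscPsi j 0 ^ 2) (y := 1) (by
    rw [mul_pow, Real.sq_sqrt (by positivity)]; exact succ_mul_oscPsi_zero_sq_sq_le j)
  rw [Real.sqrt_one] at h
  rw [le_div_iff₀ (by positivity)]
  linarith

/-- The oscillator energy `ψ'² + (2 j + 3 - r²) ψ²` of `ψ = ψ_{j+1}` decreases on `[0, ∞)`. -/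
theorem oscPsi_energy_le (j : ℕ) {r : ℝ} (hr : 0 ≤ r) :
    (2 * (j + 1) + 1 - r ^ 2) * oscPsi (j + 1) r ^ 2 ≤ 5 * √((j : ℝ) + 1) := by
  set w := √(2 * ((j : ℝ) + 1)) with hw
  have hw2 : w ^ 2 = 2 * (j + 1) := Real.sq_sqrt (by positivity)
  have hd : ∀ x : ℝ, HasDerivAt (fun x => (w * oscPsi j x - x * oscPsi (j + 1) x) ^ 2
      + (2 * (j + 1) + 1 - x ^ 2) * oscPsi (j + 1) x ^ 2) (-2 * x * oscPsi (j + 1) x ^ 2) x := by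
    intro x
    have ha := hasDerivAt_oscPsi_succ j x
    have hb := hasDerivAt_oscPsi j x
    rw [← hw] at ha hb
    have h1 := ((hb.const_mul w).fun_sub ((hasDerivAt_id x).fun_mul ha)).fun_pow 2
    have h2 := (((hasDerivAt_pow 2 x).const_sub (2 * ((j : ℝ) + 1) + 1)).fun_mul (ha.fun_pow 2))
    refine (h1.fun_add h2).congr_deriv ?_
    simp only [id]
    push_cast
    linear_combination (2 * x * oscPsi (j + 1) x - 2 * w * oscPsi j x) * oscPsi (j + 1) x * hw2
  have h := le_apply_zero_of_hasDerivAt_nonpos hd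
    (fun x hx => by nlinarith [mul_nonneg hx (sq_nonneg (oscPsi (j + 1) x))]) hr
  simp only [zero_mul, sub_zero, ne_eq, OfNat.ofNat_ne_zero, not_false_eq_true, zero_pow, mul_pow,
    hw2] at h
  have hj : (0 : ℝ) ≤ j := Nat.cast_nonneg j
  have ha := oscPsi_zero_sq_le j
  have hb : oscPsi (j + 1) 0 ^ 2 ≤ 1 / √((j : ℝ) + 1) :=
    (oscPsi_zero_sq_le (j + 1)).trans (one_div_le_one_div_of_le (by positivity)
      (Real.sqrt_le_sqrt (by push_cast; linarith)))
  have h1 : ((j : ℝ) + 1) * (1 / √((j : ℝ) + 1)) = √((j : ℝ) + 1) := by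
    rw [mul_one_div, Real.div_sqrt]
  have h2 : 0 ≤ 1 / √((j : ℝ) + 1) := by positivity
  -- The energy at the origin is at most `(4(j + 1) + 1)/√(j + 1) ≤ 5 √(j + 1)`.
  nlinarith [sq_nonneg (w * oscPsi j r - r * oscPsi (j + 1) r),
    mul_le_mul_of_nonneg_left ha (by positivity : 0 ≤ 2 * ((j : ℝ) + 1)),
    mul_le_mul_of_nonneg_left hb (by positivity : 0 ≤ 2 * ((j : ℝ) + 1) + 1)]

/-- In the bulk the potential coefficient `2n + 1 - r²` of the energy is at least `δ n`. -/
theorem oscPsi_sq_le {δ : ℝ} (hδ : 0 < δ) {n : ℕ} (hn : 1 ≤ n) {r : ℝ} (hr : 0 ≤ r)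
    (h : r ^ 2 ≤ (2 - δ) * n) : oscPsi n r ^ 2 ≤ 5 / δ / √n := by
  obtain ⟨j, rfl⟩ := Nat.exists_eq_add_of_le' hn
  have h1 := oscPsi_energy_le j hr
  push_cast at h ⊢
  have hs : 0 < √((j : ℝ) + 1) := by positivity
  have hs2 : √((j : ℝ) + 1) * √((j : ℝ) + 1) = j + 1 := Real.mul_self_sqrt (by positivity)
  rw [div_div, le_div_iff₀ (by positivity)]
  have h2 : δ * ((j : ℝ) + 1) * oscPsi (j + 1) r ^ 2 ≤ 5 * √((j : ℝ) + 1) :=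
    (mul_le_mul_of_nonneg_right (by linarith) (sq_nonneg _)).trans h1
  have h3 : δ * (√((j : ℝ) + 1) * √((j : ℝ) + 1)) * oscPsi (j + 1) r ^ 2
      ≤ 5 * √((j : ℝ) + 1) := by rwa [hs2]
  refine le_of_mul_le_mul_right ?_ hs
  linarith

theorem shellDensity_zero_eq (k : ℕ) (r : ℝ) : shellDensity 0 k r = oscPsi k r ^ 2 := by
  simp [shellDensity, shellSeries, oscSeries]

theorem shellDensity_one_eq (n : ℕ) (r : ℝ) : shellDensity 1 n r
    = ∑ p ∈ Finset.HasAntidiagonal.antidiagonal n, oscPsi p.1 r ^ 2 * oscPsi p.2 0 ^ 2 := by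
  simp [shellDensity, shellSeries, oscSeries, coeff_mul]

/-- The series is `1 / (π (1 - X²))`, with coefficients `1/π` and `0`. -/
theorem coeff_oscSeries_zero_sq_le (k : ℕ) : coeff k (oscSeries 0 ^ 2) ≤ 1 := by
  induction k using Nat.twoStepInduction with
  | zero =>
    rw [coeff_zero_oscSeries_zero_pow, div_pow, one_pow, Real.sq_sqrt Real.pi_pos.le,
      div_le_one Real.pi_pos]
    linarith [Real.pi_gt_three]
  | one => simpa using (coeff_odd_oscSeries_zero_pow 2 0).trans_le zero_le_one
  | more k ih _ =>
    have h := coeff_oscSeries_zero_pow_add_two 2 k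
    push_cast at h
    rwa [mul_left_cancel₀ (by positivity) h]

/-- Two additional dimensions convolve the shells with coefficients in `[0, 1]`. This reduces shell
bounds in dimension at least three to the uniform kernel bound two dimensions lower. -/
theorem shellDensity_add_two_le (m n : ℕ) (r : ℝ) :
    shellDensity (m + 2) n r ≤ kernelSum m (n + 1) r := by
  have h : shellSeries (m + 2) r = shellSeries m r * oscSeries 0 ^ 2 := by
    rw [shellSeries, shellSeries, pow_add, mul_assoc]
  rw [shellDensity, h, coeff_mul, kernelSum,
    ← Finset.Nat.sum_antidiagonal_eq_sum_range_succ_mk (fun p : ℕ × ℕ => shellDensity m p.1 r)]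
  refine Finset.sum_le_sum fun p _ => ?_
  exact mul_le_of_le_one_right (shellDensity_nonneg m p.1 r) (coeff_oscSeries_zero_sq_le _)

theorem kernelSum_zero_eq_antidiagonal (n : ℕ) (r : ℝ) :
    ∑ p ∈ Finset.HasAntidiagonal.antidiagonal n, oscPsi p.1 r ^ 2 = kernelSum 0 (n + 1) r := by
  rw [kernelSum, Finset.Nat.sum_antidiagonal_eq_sum_range_succ_mk]
  simp [shellDensity_zero_eq]

/-- Planar shell densities are bounded in the bulk. -/
theorem exists_shellDensity_one_le {δ : ℝ} (hδ : 0 < δ) (hδ2 : δ ≤ 2) :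
    ∃ C : ℝ, 0 ≤ C ∧ ∀ n : ℕ, 1 ≤ n → ∀ r : ℝ, 0 ≤ r → r ^ 2 ≤ (2 - δ) * n →
      shellDensity 1 n r ≤ C := by
  obtain ⟨C, hC, h⟩ := exists_kernelSum_le 0
  refine ⟨20 / δ * (4 * C), by positivity, fun n hn r hr hrn => ?_⟩
  have hn' : (1 : ℝ) ≤ n := by exact_mod_cast hn
  have hs : 0 < √(n : ℝ) := Real.sqrt_pos.2 (by linarith)
  have hfrac : ∀ {t : ℝ} {i : ℕ}, 0 < t → t ≤ 1 → t * n ≤ i → 1 / √(i : ℝ) ≤ 1 / t / √n := by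
    intro t i ht ht1 hi
    rw [div_div]
    refine one_div_le_one_div_of_le (by positivity) ?_
    refine Real.le_sqrt_of_sq_le ?_
    rw [mul_pow, Real.sq_sqrt (by positivity)]
    exact le_trans (by nlinarith [mul_nonneg (mul_nonneg ht.le (sub_nonneg.2 ht1)) (by linarith : (0 : ℝ) ≤ n)]) hi
  -- In each product one factor is `O(1/√n)`. If `p.2 ≤ δ n / 4`, then `r² ≤ (2 - δ/2) p.1` and the
  -- energy bound controls the first factor; otherwise `p.2` is large and the bound at the origin
  -- controls the second. The other factor sums to a one-dimensional kernel, of order `√n`.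
  have hterm : ∀ p ∈ Finset.HasAntidiagonal.antidiagonal n, oscPsi p.1 r ^ 2 * oscPsi p.2 0 ^ 2
      ≤ 20 / δ / √n * (oscPsi p.1 r ^ 2 + oscPsi p.2 0 ^ 2) := by
    intro p hp
    rw [Finset.HasAntidiagonal.mem_antidiagonal] at hp
    have hp' : (p.1 : ℝ) + p.2 = n := by exact_mod_cast hp
    have hA := sq_nonneg (oscPsi p.1 r)
    have hB := sq_nonneg (oscPsi p.2 0)
    have hc : 0 ≤ 20 / δ / √(n : ℝ) := by positivity
    rcases le_or_gt ((p.2 : ℝ)) (δ / 4 * n) with hle | hgt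
    · have h1 : (1 / 2 : ℝ) * n ≤ p.1 := by nlinarith
      have h1' : 1 ≤ p.1 := by
        by_contra h0
        have : p.1 = 0 := by omega
        rw [this] at h1; push_cast at h1; linarith
      have h2 : r ^ 2 ≤ (2 - δ / 2) * p.1 := by
        have : (1 - δ / 4) * n ≤ p.1 := by linarith
        nlinarith [mul_le_mul_of_nonneg_left this (by linarith : 0 ≤ 2 - δ / 2)]
      have h3 := oscPsi_sq_le (by positivity) h1' hr h2
      have h4 : oscPsi p.1 r ^ 2 ≤ 20 / δ / √n := by
        calc oscPsi p.1 r ^ 2 ≤ 10 / δ * (1 / √(p.1 : ℝ)) := by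
              refine h3.trans (le_of_eq ?_); field_simp; norm_num
          _ ≤ 10 / δ * (1 / (1 / 2) / √n) := by
              gcongr 10 / δ * ?_; exact hfrac (by norm_num) (by norm_num) h1
          _ = 20 / δ / √n := by field_simp; norm_num
      nlinarith [mul_le_mul_of_nonneg_right h4 hB, mul_nonneg hc hA]
    · have h4 : oscPsi p.2 0 ^ 2 ≤ 20 / δ / √n := by
        have hj : (0 : ℝ) < p.2 := lt_of_le_of_lt (by positivity) hgt
        calc oscPsi p.2 0 ^ 2 ≤ 1 / √((p.2 : ℝ) + 1) := oscPsi_zero_sq_le _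
          _ ≤ 1 / √(p.2 : ℝ) := one_div_le_one_div_of_le (Real.sqrt_pos.2 hj)
              (Real.sqrt_le_sqrt (by linarith))
          _ ≤ 1 / (δ / 4) / √n := hfrac (by positivity) (by linarith) hgt.le
          _ ≤ 20 / δ / √n := by
              gcongr ?_ / _
              rw [div_le_div_iff₀ (by positivity) (by positivity)]; linarith
      nlinarith [mul_le_mul_of_nonneg_left h4 hA, mul_nonneg hc hB]
  have hsum : ∑ p ∈ Finset.HasAntidiagonal.antidiagonal n, oscPsi p.2 0 ^ 2 = kernelSum 0 (n + 1) 0 := by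
    rw [← kernelSum_zero_eq_antidiagonal, ← Finset.Nat.sum_antidiagonal_swap]
    rfl
  have hK : ∀ x : ℝ, 0 ≤ x → kernelSum 0 (n + 1) x ≤ 2 * C * √n := by
    intro x hx
    have h1 := h (n + 1) (by omega) x hx
    rw [show (((0 + 1 : ℕ) : ℝ) / 2) = 1 / 2 by norm_num, ← Real.sqrt_eq_rpow] at h1
    refine h1.trans ?_
    have h2 : √((n + 1 : ℕ) : ℝ) ≤ 2 * √n := by
      rw [Real.sqrt_le_left (by positivity), mul_pow, Real.sq_sqrt (by positivity)]
      push_cast; linarith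
    nlinarith
  rw [shellDensity_one_eq]
  calc _ ≤ ∑ p ∈ Finset.HasAntidiagonal.antidiagonal n, 20 / δ / √n * (oscPsi p.1 r ^ 2 + oscPsi p.2 0 ^ 2) :=
        Finset.sum_le_sum hterm
    _ = 20 / δ / √n * (kernelSum 0 (n + 1) r + kernelSum 0 (n + 1) 0) := by
        rw [← Finset.mul_sum, Finset.sum_add_distrib, hsum, kernelSum_zero_eq_antidiagonal]
    _ ≤ 20 / δ / √n * (2 * C * √n + 2 * C * √n) := by
        gcongr
        · exact hK r hr
        · exact hK 0 le_rfl
    _ = 20 / δ * (4 * C) := by field_simp; ring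

/-- In the bulk a shell density in dimension `d` is `O(n^(d/2 - 1))`. -/
theorem exists_shellDensity_le (m : ℕ) {δ : ℝ} (hδ : 0 < δ) (hδ2 : δ ≤ 2) :
    ∃ C : ℝ, 0 ≤ C ∧ ∀ n : ℕ, 1 ≤ n → ∀ r : ℝ, 0 ≤ r → r ^ 2 ≤ (2 - δ) * n →
      shellDensity m n r ≤ C * (n : ℝ) ^ (((m + 1 : ℕ) : ℝ) / 2 - 1) := by
  rcases m with _ | _ | m
  · refine ⟨5 / δ, by positivity, fun n hn r hr h => ?_⟩
    have hn' : (0 : ℝ) < n := by exact_mod_cast hn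
    rw [shellDensity_zero_eq]
    refine (oscPsi_sq_le hδ hn hr h).trans (le_of_eq ?_)
    rw [show (((0 + 1 : ℕ) : ℝ) / 2 - 1) = -(1 / 2) by norm_num, Real.rpow_neg hn'.le,
      ← Real.sqrt_eq_rpow, div_eq_mul_inv]
  · obtain ⟨C, hC, h⟩ := exists_shellDensity_one_le hδ hδ2
    refine ⟨C, hC, fun n hn r hr hrn => ?_⟩
    rw [show (((0 + 1 + 1 : ℕ) : ℝ) / 2 - 1) = 0 by norm_num, Real.rpow_zero, mul_one]
    exact h n hn r hr hrn
  · obtain ⟨C, hC, h⟩ := exists_kernelSum_le m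
    refine ⟨C * 2 ^ (((m + 1 : ℕ) : ℝ) / 2), by positivity, fun n hn r hr _ => ?_⟩
    have hn' : (1 : ℝ) ≤ n := by exact_mod_cast hn
    refine (shellDensity_add_two_le m n r).trans ((h (n + 1) (by omega) r hr).trans ?_)
    rw [show (((m + 1 + 1 + 1 : ℕ) : ℝ) / 2 - 1) = ((m + 1 : ℕ) : ℝ) / 2 by push_cast; ring,
      mul_assoc, ← Real.mul_rpow (by norm_num) (by positivity)]
    gcongr
    push_cast
    linarith

end Bounds

/-! ### Exponential decay outside the ball -/

section Outside

/-- Subtracting consecutive relations gives `K_{n+2}' = K_n' + 2r (p_n - p_{n+1})`, so the bound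
propagates in steps of two. It gives the sign of the boundary term in the weighted sum. -/
theorem kernelSumDeriv_le (m n : ℕ) {r : ℝ} (hr : 0 ≤ r) :
    kernelSumDeriv m n r ≤ 2 * r * kernelSum m n r := by
  induction n using Nat.twoStepInduction with
  | zero => simp [kernelSumDeriv, kernelSum]
  | one =>
    have h := kernelSumDeriv_add_succ m 0 r
    have h1 := kernelSum_nonneg m 1 r
    have h2 := shellDensity_nonneg m 0 r
    have h3 : kernelSumDeriv m 0 r = 0 := by simp [kernelSumDeriv]
    nlinarith [mul_nonneg hr h1, mul_nonneg hr h2]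
  | more n ih _ =>
    have h1 := kernelSumDeriv_add_succ m n r
    have h2 := kernelSumDeriv_add_succ m (n + 1) r
    have h3 := kernelSum_succ m n r
    have h4 := kernelSum_succ m (n + 1) r
    have h5 := mul_nonneg hr (shellDensity_nonneg m n r)
    have h6 := mul_nonneg hr (shellDensity_nonneg m (n + 1) r)
    rw [h4, h3]
    linarith

/-- `∑_{k ≤ n} q^k K_k` decays at least like `exp (-r² (1 - q) / (1 + q))`. -/
theorem kernelSum_weighted_le (m n : ℕ) {q r : ℝ} (hq : 0 < q) (hr : 0 ≤ r) :
    ∑ k ∈ Finset.range (n + 1), q ^ k * kernelSum m k r ≤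
      exp (-((1 - q) / (1 + q)) * r ^ 2) *
        ∑ k ∈ Finset.range (n + 1), q ^ k * kernelSum m k 0 := by
  set c := (1 - q) / (1 + q) with hc
  set T : ℝ → ℝ := fun r => ∑ k ∈ Finset.range (n + 1), q ^ k * kernelSum m k r with hT
  have hd : ∀ x, HasDerivAt T (∑ k ∈ Finset.range (n + 1), q ^ k * kernelSumDeriv m k x) x :=
    fun x => HasDerivAt.fun_sum fun k _ => (hasDerivAt_kernelSum m k x).const_mul _
  have he : ∀ x : ℝ, HasDerivAt (fun x => exp (c * x ^ 2)) (exp (c * x ^ 2) * (c * (2 * x))) x :=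
    fun x => by
      have := ((hasDerivAt_pow 2 x).const_mul c).exp
      refine this.congr_deriv ?_
      norm_num
  -- Summation by parts leaves the exact flow equation plus a boundary term, nonpositive for `x ≥ 0`
  -- by `kernelSumDeriv_le`.
  have hsum : ∀ x, (1 + q) * ∑ k ∈ Finset.range (n + 1), q ^ k * kernelSumDeriv m k x
      = -2 * x * ((1 - q) * T x) + q ^ (n + 1) * (kernelSumDeriv m n x
        - 2 * x * kernelSum m n x) := by
    intro x
    simp only [hT]
    clear hd he hT T
    induction n with
    | zero => simp [kernelSum, kernelSumDeriv]
    | succ n ih =>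
      rw [Finset.sum_range_succ _ (n + 1), Finset.sum_range_succ _ (n + 1), mul_add, ih]
      have h1 := kernelSumDeriv_add_succ m n x
      have h2 := kernelSum_succ m n x
      linear_combination q ^ (n + 1) * h1 + 2 * x * q ^ (n + 1) * h2
  have hle : ∀ x, 0 ≤ x → (∑ k ∈ Finset.range (n + 1), q ^ k * kernelSumDeriv m k x)
      ≤ -2 * x * c * T x := by
    intro x hx
    have h1 := hsum x
    have h2 := mul_nonneg (pow_pos hq (n + 1)).le (sub_nonneg.2 (kernelSumDeriv_le m n hx))
    have h3 : (1 + q) * c = 1 - q := by rw [hc]; field_simp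
    refine le_of_mul_le_mul_left ?_ (by linarith : 0 < 1 + q)
    rw [h1, show (1 + q) * (-2 * x * c * T x) = -2 * x * ((1 + q) * c * T x) by ring, h3]
    linarith
  have h := le_apply_zero_of_hasDerivAt_nonpos (fun x => (hd x).fun_mul (he x))
    (fun x hx => by nlinarith [mul_le_mul_of_nonneg_left (hle x hx) (exp_pos (c * x ^ 2)).le]) hr
  simp only [ne_eq, OfNat.ofNat_ne_zero, not_false_eq_true, zero_pow, mul_zero, exp_zero,
    mul_one] at h
  rw [neg_mul, exp_neg, ← div_eq_inv_mul, le_div_iff₀ (exp_pos _)]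
  exact h

/-- Exponential decay of the kernel outside the limiting ball. -/
theorem exists_kernelSum_exp_le (m : ℕ) {δ : ℝ} (hδ : 0 < δ) :
    ∃ C c : ℝ, 0 < C ∧ 0 < c ∧ ∀ n : ℕ, 1 ≤ n → ∀ r : ℝ, 0 ≤ r → (2 + δ) * n ≤ r ^ 2 →
      kernelSum m n r ≤ C * (n : ℝ) ^ (((m + 1 : ℕ) : ℝ) / 2) * n * exp (-c * n) := by
  obtain ⟨C, hC, hK⟩ := exists_kernelSum_zero_le m
  -- With `q = 1/(1 + η)` the cost `q^(-n)` is at most `exp(η n)`, the gain is `exp(-η (2 + δ) n/(2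
  -- + η))`, and for `δ = 4η` the net exponent is `-3η² n/(2 + η)`.
  set η := δ / 4 with hη
  have hη0 : 0 < η := by positivity
  set q := 1 / (1 + η) with hq
  have hq0 : 0 < q := by positivity
  have hq1 : q ≤ 1 := by rw [hq, div_le_one (by positivity)]; linarith
  refine ⟨2 * C, 3 * η ^ 2 / (2 + η), by positivity, by positivity, fun n hn r hr hrn => ?_⟩
  have hn' : (1 : ℝ) ≤ n := by exact_mod_cast hn
  have h0 := kernelSum_weighted_le m n hq0 hr
  have hc : (1 - q) / (1 + q) = η / (2 + η) := by
    rw [hq]; field_simp; ring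
  rw [hc] at h0
  have h1 : q ^ n * kernelSum m n r ≤ ∑ k ∈ Finset.range (n + 1), q ^ k * kernelSum m k r :=
    Finset.single_le_sum (f := fun k => q ^ k * kernelSum m k r)
      (fun k _ => mul_nonneg (pow_nonneg hq0.le _) (kernelSum_nonneg m k r))
      (Finset.self_mem_range_succ n)
  have h2 : ∑ k ∈ Finset.range (n + 1), q ^ k * kernelSum m k 0
      ≤ 2 * C * (n : ℝ) ^ (((m + 1 : ℕ) : ℝ) / 2) * n := by
    have : ∀ k ∈ Finset.range (n + 1), q ^ k * kernelSum m k 0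
        ≤ C * (n : ℝ) ^ (((m + 1 : ℕ) : ℝ) / 2) := fun k hk => by
      have h3 := kernelSum_mono m 0 (Nat.lt_succ_iff.1 (Finset.mem_range.1 hk))
      calc q ^ k * kernelSum m k 0 ≤ 1 * kernelSum m k 0 :=
            mul_le_mul_of_nonneg_right (pow_le_one₀ hq0.le hq1) (kernelSum_nonneg m k 0)
        _ ≤ _ := by rw [one_mul]; exact h3.trans (hK n hn)
    refine (Finset.sum_le_card_nsmul _ _ _ this).trans ?_
    rw [Finset.card_range, nsmul_eq_mul, show ((n + 1 : ℕ) : ℝ) = n + 1 by push_cast; rfl]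
    have h4 : 0 ≤ C * (n : ℝ) ^ (((m + 1 : ℕ) : ℝ) / 2) := by positivity
    nlinarith
  have hqn : (q ^ n)⁻¹ ≤ exp (η * n) := by
    rw [hq, one_div, inv_pow, inv_inv, mul_comm η, Real.exp_nat_mul]
    exact pow_le_pow_left₀ (by positivity) (by linarith [Real.add_one_le_exp η]) n
  have h3 : kernelSum m n r ≤ (q ^ n)⁻¹ * (exp (-(η / (2 + η)) * r ^ 2) *
      (2 * C * (n : ℝ) ^ (((m + 1 : ℕ) : ℝ) / 2) * n)) := by
    rw [← div_eq_inv_mul, le_div_iff₀ (by positivity), mul_comm]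
    exact h1.trans (h0.trans (mul_le_mul_of_nonneg_left h2 (exp_pos _).le))
  have h4 : exp (-(η / (2 + η)) * r ^ 2) ≤ exp (-(η / (2 + η)) * ((2 + δ) * n)) := by
    refine exp_le_exp.2 ?_
    rw [neg_mul, neg_mul]
    exact neg_le_neg (mul_le_mul_of_nonneg_left hrn (by positivity))
  calc kernelSum m n r ≤ exp (η * n) * (exp (-(η / (2 + η)) * ((2 + δ) * n)) *
      (2 * C * (n : ℝ) ^ (((m + 1 : ℕ) : ℝ) / 2) * n)) := h3.trans (by gcongr)
    _ = 2 * C * (n : ℝ) ^ (((m + 1 : ℕ) : ℝ) / 2) * n *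
        (exp (η * n) * exp (-(η / (2 + η)) * ((2 + δ) * n))) := by ring
    _ = _ := by
      rw [← exp_add]
      congr 2
      rw [show δ = 4 * η by rw [hη]; ring]
      field_simp
      ring

end Outside

/-! ### Bulk asymptotics by integration by parts -/

section Bulk

theorem exists_abs_kernelPotential_le (m : ℕ) {δ : ℝ} (hδ : 0 < δ) (hδ2 : δ ≤ 2) :
    ∃ C : ℝ, 0 ≤ C ∧ ∀ n : ℕ, 1 ≤ n → 4 / δ ≤ n → ∀ r : ℝ, 0 ≤ r →
      r ^ 2 ≤ (2 - δ) * (n + 1) →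
      |kernelPotential m n r| ≤ C * ((n : ℝ) + 1) ^ (((m + 1 : ℕ) : ℝ) / 2) := by
  -- Half of `δ` absorbs the index shift: for `n ≥ 4/δ`, `(2 - δ)(n + 1) ≤ (2 - δ/2) n`.
  obtain ⟨C₁, hC₁, h₁⟩ := exists_shellDensity_le m (half_pos hδ) (by linarith)
  obtain ⟨C₂, hC₂, h₂⟩ := exists_kernelSum_le m
  refine ⟨2 * C₁ + (m + 1) * C₁ + m * C₂, by positivity, fun n hn hnδ r hr hrn => ?_⟩
  have hn' : (1 : ℝ) ≤ n := by exact_mod_cast hn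
  set e := ((m + 1 : ℕ) : ℝ) / 2 with he
  have he0 : 0 ≤ e := by positivity
  set Y := ((n : ℝ) + 1) ^ e with hY
  have hY0 : 0 < Y := Real.rpow_pos_of_pos (by positivity) _
  have h4 : 4 ≤ n * δ := by rwa [div_le_iff₀ hδ] at hnδ
  have hp1 : ((n : ℝ) + 1) * shellDensity m (n + 1) r ≤ C₁ * Y := by
    have h := h₁ (n + 1) (by omega) r hr (by push_cast; nlinarith)
    push_cast at h
    rw [Real.rpow_sub_one (by positivity), ← mul_div_assoc, le_div_iff₀ (by positivity)] at h
    linarith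
  have hp2 : (n : ℝ) * shellDensity m n r ≤ C₁ * Y := by
    have h := h₁ n hn r hr (by nlinarith)
    rw [Real.rpow_sub_one (by positivity), ← mul_div_assoc, le_div_iff₀ (by positivity)] at h
    have h5 : (n : ℝ) ^ e ≤ Y := Real.rpow_le_rpow (by positivity) (by linarith) he0
    nlinarith [mul_le_mul_of_nonneg_left h5 hC₁]
  have hK : kernelSum m (n + 1) r ≤ C₂ * Y := by
    have h := h₂ (n + 1) (by omega) r hr
    push_cast at h
    exact h
  have q1 := shellDensity_nonneg m (n + 1) r
  have q2 := shellDensity_nonneg m n r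
  have q3 := kernelSum_nonneg m (n + 1) r
  have hp3 : shellDensity m n r ≤ C₁ * Y := le_trans (by nlinarith) hp2
  have hm : (0 : ℝ) ≤ m := Nat.cast_nonneg m
  have r1 : 0 ≤ ((n : ℝ) + 1) * shellDensity m (n + 1) r := by positivity
  have r2 : 0 ≤ (n : ℝ) * shellDensity m n r := by positivity
  have r3 := mul_nonneg (by positivity : 0 ≤ ((m : ℝ) + 1)) q2
  have r4 := mul_nonneg hm q3
  have s3 := mul_le_mul_of_nonneg_left hp3 (by positivity : 0 ≤ ((m : ℝ) + 1))
  have s4 := mul_le_mul_of_nonneg_left hK hm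
  have hCY : 0 ≤ C₁ * Y := by positivity
  have hCY2 : 0 ≤ ((m : ℝ) + 1) * (C₁ * Y) := by positivity
  have hCY3 : 0 ≤ (m : ℝ) * (C₂ * Y) := by positivity
  rw [kernelPotential, abs_le]
  constructor <;> linarith

/-- Integrating by parts, `K_n / (2 n - r²)^(d/2)` is constant up to `O(1/n)` in the bulk. -/
theorem exists_abs_kernelSum_mul_rpow_sub_le (m : ℕ) {δ : ℝ} (hδ : 0 < δ) (hδ2 : δ ≤ 2) :
    ∃ C : ℝ, 0 ≤ C ∧ ∀ n : ℕ, 2 ≤ n → 4 / δ + 1 ≤ n → ∀ r : ℝ, 0 ≤ r →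
      r ^ 2 ≤ (2 - δ) * n →
      |kernelSum m n r * (2 * n - r ^ 2) ^ (-(((m + 1 : ℕ) : ℝ) / 2))
        - kernelSum m n 0 * (2 * n) ^ (-(((m + 1 : ℕ) : ℝ) / 2))| ≤ C / n := by
  obtain ⟨C, hC, hV⟩ := exists_abs_kernelPotential_le m hδ hδ2
  set e := ((m + 1 : ℕ) : ℝ) / 2 with he
  have he0 : 0 ≤ e := by positivity
  refine ⟨4 * (e + 1) * C * δ ^ (-e - 2) + 2 * (C * δ ^ (-e - 1)), by positivity,
    fun n hn hnδ r hr hrn => ?_⟩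
  obtain ⟨k, rfl⟩ := Nat.exists_eq_add_of_le' (by omega : 1 ≤ n)
  have hk : 1 ≤ k := by omega
  push_cast at hnδ hrn ⊢
  have hkδ : 4 / δ ≤ k := by linarith
  set N : ℝ := (k : ℝ) + 1 with hN
  have hN0 : 0 < N := by positivity
  have hdom : ∀ x ∈ Set.Icc 0 r, x ^ 2 ≤ (2 - δ) * N := fun x hx =>
    (pow_le_pow_left₀ hx.1 hx.2 2).trans hrn
  have hy : ∀ x ∈ Set.Icc 0 r, δ * N ≤ 2 * N - x ^ 2 := fun x hx => by linarith [hdom x hx]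
  have hy0 : ∀ x ∈ Set.Icc 0 r, 0 < 2 * N - x ^ 2 := fun x hx =>
    lt_of_lt_of_le (by positivity) (hy x hx)
  have hpow : ∀ x ∈ Set.Icc 0 r, ∀ s : ℝ, 0 ≤ s →
      (2 * N - x ^ 2) ^ (-e - s) * N ^ e ≤ δ ^ (-e - s) * N ^ (-s) := fun x hx s hs => by
    calc (2 * N - x ^ 2) ^ (-e - s) * N ^ e ≤ (δ * N) ^ (-e - s) * N ^ e :=
          mul_le_mul_of_nonneg_right (Real.rpow_le_rpow_of_nonpos (by positivity) (hy x hx)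
            (by linarith)) (by positivity)
      _ = δ ^ (-e - s) * N ^ (-s) := by
        rw [Real.mul_rpow hδ.le hN0.le, mul_assoc, ← Real.rpow_add hN0]
        congr 2
        ring
  -- Subtracting the boundary term of the integration by parts removes `V'` from the derivative,
  -- leaving only `V`, which is under control.
  set S : ℝ → ℝ := fun x => kernelSum m (k + 1) x * (2 * N - x ^ 2) ^ (-e)
    - kernelPotential m k x * (2 * N - x ^ 2) ^ (-e - 1) with hS
  have hderiv : ∀ x ∈ Set.Icc 0 r, HasDerivAt S
      (-(2 * (e + 1) * x) * (kernelPotential m k x * (2 * N - x ^ 2) ^ (-e - 2))) x := by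
    intro x hx
    have h0 := hy0 x hx
    have hb : HasDerivAt (fun x : ℝ => 2 * N - x ^ 2) (-(2 * x)) x := by
      simpa using (hasDerivAt_pow 2 x).const_sub (2 * N)
    have h1 := (hasDerivAt_kernelSum m (k + 1) x).fun_mul
      (hb.rpow_const (p := -e) (Or.inl h0.ne'))
    have h2 := (hasDerivAt_kernelPotential m k x).fun_mul
      (hb.rpow_const (p := -e - 1) (Or.inl h0.ne'))
    refine (h1.fun_sub h2).congr_deriv ?_
    have e1 : (2 * N - x ^ 2) ^ (-e) = (2 * N - x ^ 2) ^ (-e - 1) * (2 * N - x ^ 2) := by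
      rw [← Real.rpow_add_one h0.ne']; congr 1; ring
    have e2 : (-e - 1 - 1 : ℝ) = -e - 2 := by ring
    have e3 : (m : ℝ) + 1 = 2 * e := by rw [he]; push_cast; ring
    rw [e1, e2, e3, ← hN]
    ring
  have hbound : ∀ x ∈ Set.Icc 0 r,
      ‖-(2 * (e + 1) * x) * (kernelPotential m k x * (2 * N - x ^ 2) ^ (-e - 2))‖
        ≤ 2 * (e + 1) * r * (C * (δ ^ (-e - 2) * N ^ (-2 : ℝ))) := by
    intro x hx
    have h1 := hV k hk hkδ x hx.1 (hdom x hx)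
    have h2 := hpow x hx 2 (by norm_num)
    have h3 : 0 ≤ (2 * N - x ^ 2) ^ (-e - 2) := Real.rpow_nonneg (hy0 x hx).le _
    rw [Real.norm_eq_abs, abs_mul, abs_neg, abs_mul (kernelPotential m k x), abs_of_nonneg h3,
      abs_of_nonneg (mul_nonneg (by positivity) hx.1)]
    refine mul_le_mul (mul_le_mul_of_nonneg_left hx.2 (by positivity)) ?_ (by positivity)
      (by positivity)
    calc |kernelPotential m k x| * (2 * N - x ^ 2) ^ (-e - 2)
        ≤ C * N ^ e * (2 * N - x ^ 2) ^ (-e - 2) := mul_le_mul_of_nonneg_right h1 h3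
      _ = C * ((2 * N - x ^ 2) ^ (-e - 2) * N ^ e) := by ring
      _ ≤ _ := mul_le_mul_of_nonneg_left h2 hC
  have h0mem : (0 : ℝ) ∈ Set.Icc 0 r := ⟨le_rfl, hr⟩
  have hrmem : r ∈ Set.Icc 0 r := ⟨hr, le_rfl⟩
  -- The derivative is `O(r / N²)` on an interval of length `r`, and `r² ≤ 2N`, so the increment is
  -- `O(1/N)`.
  have hmvt := (convex_Icc 0 r).norm_image_sub_le_of_norm_hasDerivWithin_le
    (fun x hx => (hderiv x hx).hasDerivWithinAt) hbound h0mem hrmem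
  have hmain : |S r - S 0| ≤ 4 * (e + 1) * C * δ ^ (-e - 2) / N := by
    refine hmvt.trans ?_
    rw [sub_zero, Real.norm_of_nonneg hr, Real.rpow_neg hN0.le, Real.rpow_two]
    have h1 : r ^ 2 ≤ 2 * N := hrn.trans (by nlinarith)
    calc 2 * (e + 1) * r * (C * (δ ^ (-e - 2) * (N ^ 2)⁻¹)) * r
        = 2 * (e + 1) * C * δ ^ (-e - 2) * (N ^ 2)⁻¹ * r ^ 2 := by ring
      _ ≤ 2 * (e + 1) * C * δ ^ (-e - 2) * (N ^ 2)⁻¹ * (2 * N) := by gcongr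
      _ = _ := by field_simp; ring
  have hcorr : ∀ x ∈ Set.Icc 0 r,
      |kernelPotential m k x * (2 * N - x ^ 2) ^ (-e - 1)| ≤ C * δ ^ (-e - 1) / N := by
    intro x hx
    have h1 := hV k hk hkδ x hx.1 (hdom x hx)
    have h2 := hpow x hx 1 (by norm_num)
    have h3 : 0 ≤ (2 * N - x ^ 2) ^ (-e - 1) := Real.rpow_nonneg (hy0 x hx).le _
    rw [abs_mul, abs_of_nonneg h3]
    calc |kernelPotential m k x| * (2 * N - x ^ 2) ^ (-e - 1)
        ≤ C * N ^ e * (2 * N - x ^ 2) ^ (-e - 1) := mul_le_mul_of_nonneg_right h1 h3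
      _ = C * ((2 * N - x ^ 2) ^ (-e - 1) * N ^ e) := by ring
      _ ≤ C * (δ ^ (-e - 1) * N ^ (-1 : ℝ)) := mul_le_mul_of_nonneg_left h2 hC
      _ = _ := by rw [Real.rpow_neg_one]; ring
  have hc1 := hcorr r hrmem
  have hc2 := hcorr 0 h0mem
  have hS0 : S 0 = kernelSum m (k + 1) 0 * (2 * N) ^ (-e)
      - kernelPotential m k 0 * (2 * N - 0 ^ 2) ^ (-e - 1) := by
    simp [hS]
  have hid : kernelSum m (k + 1) r * (2 * N - r ^ 2) ^ (-e) - kernelSum m (k + 1) 0 * (2 * N) ^ (-e)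
      = (S r - S 0) + kernelPotential m k r * (2 * N - r ^ 2) ^ (-e - 1)
        - kernelPotential m k 0 * (2 * N - 0 ^ 2) ^ (-e - 1) := by
    rw [hS0]; simp only [hS]; ring
  rw [hid]
  refine (abs_sub _ _).trans ?_
  refine (add_le_add ((abs_add_le _ _).trans (add_le_add hmain hc1)) hc2).trans (le_of_eq ?_)
  ring

/-- Bulk asymptotics of the kernel with error `O(n^(d/2 - 1))`. -/
theorem exists_abs_kernelSum_sub_le (m : ℕ) {δ : ℝ} (hδ : 0 < δ) (hδ2 : δ ≤ 2) :
    ∃ C : ℝ, 0 ≤ C ∧ ∀ n : ℕ, 2 ≤ n → 4 / δ + 1 ≤ n → ∀ r : ℝ, 0 ≤ r →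
      r ^ 2 ≤ (2 - δ) * n →
      |kernelSum m n r - originConst (m + 1) / 2 ^ (m + 1) *
          (2 * n - r ^ 2) ^ (((m + 1 : ℕ) : ℝ) / 2)|
        ≤ C * (n : ℝ) ^ (((m + 1 : ℕ) : ℝ) / 2) / n := by
  obtain ⟨C₁, hC₁, h₁⟩ := exists_abs_kernelSum_mul_rpow_sub_le m hδ hδ2
  obtain ⟨C₂, hC₂, h₂⟩ := exists_abs_kernelSum_zero_sub_le m
  set e := ((m + 1 : ℕ) : ℝ) / 2 with he
  have he0 : 0 ≤ e := by positivity
  refine ⟨(C₁ + 2 * C₂) * 2 ^ e, by positivity, fun n hn hnδ r hr hrn => ?_⟩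
  have hn0 : (0 : ℝ) < n := by
    have : 0 < n := by omega
    exact_mod_cast this
  have hy : 0 < 2 * (n : ℝ) - r ^ 2 := by nlinarith
  have h3 := h₁ n hn hnδ r hr hrn
  have h4 := h₂ n (by omega)
  have h2n : 0 < 2 * (n : ℝ) := by positivity
  have h4e : (2 : ℝ) ^ (m + 1) = 2 ^ e * 2 ^ e := by
    rw [← Real.rpow_add (by norm_num), ← Real.rpow_natCast]; congr 1; rw [he]; ring
  -- Source of the factor `2^(-d)`: the origin asymptotics use `n/2`, the normalization uses `2n`.
  have hhalf : ((n : ℝ) / 2) ^ e = (2 * (n : ℝ)) ^ e / 2 ^ (m + 1) := by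
    rw [h4e, Real.div_rpow hn0.le (by norm_num), Real.mul_rpow (by norm_num) hn0.le]
    have : (2 : ℝ) ^ e ≠ 0 := by positivity
    field_simp
  have h5 : |kernelSum m n 0 * (2 * n) ^ (-e) - originConst (m + 1) / 2 ^ (m + 1)|
      ≤ 2 * C₂ / n := by
    have hA : 0 < (2 * (n : ℝ)) ^ e := by positivity
    rw [Real.rpow_neg h2n.le]
    have : kernelSum m n 0 * ((2 * (n : ℝ)) ^ e)⁻¹ - originConst (m + 1) / 2 ^ (m + 1)
        = (kernelSum m n 0 - originConst (m + 1) * ((n : ℝ) / 2) ^ e) * ((2 * (n : ℝ)) ^ e)⁻¹ := by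
      rw [hhalf]; field_simp
    rw [this, abs_mul, abs_of_pos (inv_pos.2 hA)]
    calc _ ≤ C₂ * ((n : ℝ) / 2) ^ (e - 1) * ((2 * (n : ℝ)) ^ e)⁻¹ :=
          mul_le_mul_of_nonneg_right h4 (inv_pos.2 hA).le
      _ = 2 * C₂ / n * (1 / 2 ^ (m + 1)) := by
        rw [Real.rpow_sub_one (by positivity), hhalf]; field_simp
      _ ≤ 2 * C₂ / n * 1 := by
        gcongr
        rw [div_le_one (by positivity)]
        exact one_le_pow₀ (by norm_num)
      _ = _ := mul_one _
  have h6 : |kernelSum m n r * (2 * n - r ^ 2) ^ (-e) - originConst (m + 1) / 2 ^ (m + 1)|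
      ≤ (C₁ + 2 * C₂) / n := by
    refine (abs_sub_le _ _ _).trans ((add_le_add h3 h5).trans (le_of_eq ?_))
    ring
  have hB : 0 < (2 * (n : ℝ) - r ^ 2) ^ e := Real.rpow_pos_of_pos hy _
  have h7 : kernelSum m n r - originConst (m + 1) / 2 ^ (m + 1) * (2 * n - r ^ 2) ^ e
      = (kernelSum m n r * (2 * n - r ^ 2) ^ (-e) - originConst (m + 1) / 2 ^ (m + 1))
        * (2 * n - r ^ 2) ^ e := by
    rw [Real.rpow_neg hy.le, sub_mul, mul_assoc, inv_mul_cancel₀ hB.ne', mul_one]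
  rw [h7, abs_mul, abs_of_pos hB]
  calc _ ≤ (C₁ + 2 * C₂) / n * (2 * (n : ℝ)) ^ e := by
        refine mul_le_mul h6 (Real.rpow_le_rpow hy.le (by nlinarith) he0) hB.le (by positivity)
    _ = _ := by rw [Real.mul_rpow (by norm_num) hn0.le]; ring

end Bulk

/-! ### Rescaling and uniformity on compact sets -/

section Main

theorem exists_norm_sq_le_of_isCompact {E : Type*} [NormedAddCommGroup E] {K : Set E}
    (hK : IsCompact K) (h : ∀ x ∈ K, ‖x‖ < √2) :
    ∃ δ : ℝ, 0 < δ ∧ δ ≤ 2 ∧ ∀ x ∈ K, ‖x‖ ^ 2 ≤ 2 - δ := by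
  rcases K.eq_empty_or_nonempty with rfl | hne
  · exact ⟨2, by norm_num, le_rfl, by simp⟩
  obtain ⟨x₀, hx₀, hmax⟩ := hK.exists_isMaxOn hne continuous_norm.continuousOn
  have h2 : ‖x₀‖ ^ 2 < 2 := (Real.lt_sqrt (norm_nonneg _)).1 (h x₀ hx₀)
  refine ⟨2 - ‖x₀‖ ^ 2, by linarith, by linarith [sq_nonneg ‖x₀‖], fun x hx => ?_⟩
  have := pow_le_pow_left₀ (norm_nonneg x) (hmax hx) 2
  linarith

theorem exists_le_norm_sq_of_isCompact {E : Type*} [NormedAddCommGroup E] {K : Set E}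
    (hK : IsCompact K) (h : ∀ x ∈ K, √2 < ‖x‖) :
    ∃ δ : ℝ, 0 < δ ∧ ∀ x ∈ K, 2 + δ ≤ ‖x‖ ^ 2 := by
  rcases K.eq_empty_or_nonempty with rfl | hne
  · exact ⟨2, by norm_num, by simp⟩
  obtain ⟨x₀, hx₀, hmin⟩ := hK.exists_isMinOn hne continuous_norm.continuousOn
  have h2 : 2 < ‖x₀‖ ^ 2 := (Real.sqrt_lt' (lt_of_le_of_lt (Real.sqrt_nonneg 2) (h x₀ hx₀))).1
    (h x₀ hx₀)
  refine ⟨‖x₀‖ ^ 2 - 2, by linarith, fun x hx => ?_⟩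
  have := pow_le_pow_left₀ (norm_nonneg x₀) (hmin hx) 2
  linarith

theorem rpow_half_mul_rpow_half {x : ℝ} (hx : 0 < x) (d : ℕ) :
    x ^ ((d : ℝ) / 2) * x ^ ((d : ℝ) / 2) = x ^ d := by
  rw [← Real.rpow_add hx, add_halves, Real.rpow_natCast]

theorem scaledFermiKernel_bulk (m : ℕ) {K : Set (EuclideanSpace ℝ (Fin (m + 1)))}
    (hK : IsCompact K) (h : ∀ X ∈ K, ‖X‖ < √2) :
    ∃ C : ℝ, ∀ᶠ n : ℕ in atTop, ∀ X ∈ K,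
      |1 / ((n : ℝ) ^ (m + 1) / ((m + 1)! : ℝ)) * scaledFermiKernel n X X
        - ((m + 1)! : ℝ) / (2 ^ (m + 1) * π ^ (((m + 1 : ℕ) : ℝ) / 2))
          * ((2 - ‖X‖ ^ 2) ^ (((m + 1 : ℕ) : ℝ) / 2) / Real.Gamma (((m + 1 : ℕ) : ℝ) / 2 + 1))|
        ≤ C * (1 / (n : ℝ)) := by
  obtain ⟨δ, hδ, hδ2, hKδ⟩ := exists_norm_sq_le_of_isCompact hK h
  obtain ⟨C, hC, hmain⟩ := exists_abs_kernelSum_sub_le m hδ hδ2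
  refine ⟨((m + 1)! : ℝ) * C, ?_⟩
  filter_upwards [eventually_ge_atTop 2, eventually_ge_atTop ⌈4 / δ + 1⌉₊] with n hn hnδ X hX
  have hn0 : (0 : ℝ) < n := by
    have : 0 < n := by omega
    exact_mod_cast this
  have hr2 : (√n * ‖X‖) ^ 2 = n * ‖X‖ ^ 2 := by rw [mul_pow, Real.sq_sqrt hn0.le]
  have h1 := hmain n hn (Nat.ceil_le.1 hnδ) (√n * ‖X‖) (by positivity)
    (by rw [hr2]; nlinarith [hKδ X hX])
  have hb : 0 ≤ 2 - ‖X‖ ^ 2 := by linarith [hKδ X hX]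
  rw [hr2, show 2 * (n : ℝ) - n * ‖X‖ ^ 2 = n * (2 - ‖X‖ ^ 2) by ring,
    Real.mul_rpow hn0.le hb] at h1
  have hpi : (1 / √π) ^ (m + 1) = 1 / π ^ (((m + 1 : ℕ) : ℝ) / 2) := by
    rw [div_pow, one_pow, Real.sqrt_eq_rpow, ← Real.rpow_natCast, ← Real.rpow_mul Real.pi_pos.le]
    congr 2
    ring
  have hnn := rpow_half_mul_rpow_half hn0 (m + 1)
  rw [originConst, hpi] at h1
  rw [scaledFermiKernel_self]
  have hG : Gamma (((m + 1 : ℕ) : ℝ) / 2 + 1) ≠ 0 := (Gamma_pos_of_pos (by positivity)).ne'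
  have hP : π ^ (((m + 1 : ℕ) : ℝ) / 2) ≠ 0 := (Real.rpow_pos_of_pos Real.pi_pos _).ne'
  have hE : 0 < (n : ℝ) ^ (((m + 1 : ℕ) : ℝ) / 2) := Real.rpow_pos_of_pos hn0 _
  have hf : (0 : ℝ) < (m + 1)! := by positivity
  generalize Gamma (((m + 1 : ℕ) : ℝ) / 2 + 1) = g at *
  generalize π ^ (((m + 1 : ℕ) : ℝ) / 2) = p at *
  generalize (2 - ‖X‖ ^ 2) ^ (((m + 1 : ℕ) : ℝ) / 2) = b at *
  generalize (n : ℝ) ^ (((m + 1 : ℕ) : ℝ) / 2) = E at *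
  generalize kernelSum m n (√n * ‖X‖) = κ at *
  generalize (((m + 1)! : ℕ) : ℝ) = f at *
  rw [← hnn]
  -- Here `E = n^(d/2)`, so `n^d = E * E`; the error `O(E/n)` of the kernel is multiplied by `d!/E`.
  have hid : 1 / (E * E / f) * (E * κ) - f / (2 ^ (m + 1) * p) * (b / g)
      = f / E * (κ - 1 / p / g / 2 ^ (m + 1) * (E * b)) := by
    field_simp
  rw [hid, abs_mul, abs_of_pos (div_pos hf hE)]
  refine (mul_le_mul_of_nonneg_left h1 (div_pos hf hE).le).trans (le_of_eq ?_)
  field_simp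

theorem scaledFermiKernel_outside (m : ℕ) {K : Set (EuclideanSpace ℝ (Fin (m + 1)))}
    (hK : IsCompact K) (h : ∀ X ∈ K, √2 < ‖X‖) :
    ∃ C c : ℝ, 0 < c ∧ ∀ᶠ n : ℕ in atTop, ∀ X ∈ K,
      |scaledFermiKernel n X X| ≤ C * exp (-c * (n : ℝ)) := by
  obtain ⟨δ, hδ, hKδ⟩ := exists_le_norm_sq_of_isCompact hK h
  obtain ⟨C, c, hC, hc, hmain⟩ := exists_kernelSum_exp_le m hδ
  -- Half of the decay rate is spent on the polynomial prefactor `n^(d + 1)`, where `d = m + 1`.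
  have hlim := (tendsto_rpow_mul_exp_neg_mul_atTop_nhds_zero ((m + 2 : ℕ) : ℝ) (c / 2)
    (half_pos hc)).comp tendsto_natCast_atTop_atTop
  refine ⟨C, c / 2, half_pos hc, ?_⟩
  filter_upwards [eventually_ge_atTop 1, hlim.eventually_le_const one_pos] with n hn hle X hX
  have hn0 : (0 : ℝ) < n := by exact_mod_cast hn
  have hr2 : (√n * ‖X‖) ^ 2 = n * ‖X‖ ^ 2 := by rw [mul_pow, Real.sq_sqrt hn0.le]
  have h1 := hmain n hn (√n * ‖X‖) (by positivity) (by rw [hr2]; nlinarith [hKδ X hX])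
  have hE : 0 < (n : ℝ) ^ (((m + 1 : ℕ) : ℝ) / 2) := Real.rpow_pos_of_pos hn0 _
  have hnn := rpow_half_mul_rpow_half hn0 (m + 1)
  rw [scaledFermiKernel_self, abs_of_nonneg (mul_nonneg hE.le (kernelSum_nonneg _ _ _))]
  simp only [Function.comp_apply, Real.rpow_natCast] at hle
  calc _ ≤ (n : ℝ) ^ (((m + 1 : ℕ) : ℝ) / 2) *
        (C * (n : ℝ) ^ (((m + 1 : ℕ) : ℝ) / 2) * n * exp (-c * n)) :=
        mul_le_mul_of_nonneg_left h1 hE.le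
    _ = C * ((n : ℝ) ^ (m + 2) * exp (-(c / 2) * n)) * exp (-(c / 2) * n) := by
      have hexp : exp (-c * n) = exp (-(c / 2) * n) * exp (-(c / 2) * n) := by
        rw [← exp_add]; congr 1; ring
      rw [hexp, pow_succ (n : ℝ) (m + 1), ← hnn]
      ring
    _ ≤ C * 1 * exp (-(c / 2) * n) := by gcongr
    _ = _ := by rw [mul_one]

end Main

theorem mainTheorem3 (d : ℕ) (hd : 1 ≤ d) :
    (∀ K : Set (EuclideanSpace ℝ (Fin d)), IsCompact K → (∀ X ∈ K, ‖X‖ < √2) →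
      ∃ C : ℝ, ∀ᶠ n : ℕ in atTop, ∀ X ∈ K,
        |1 / ((n : ℝ) ^ d / (d ! : ℝ)) * scaledFermiKernel n X X
          - (d ! : ℝ) / (2 ^ d * π ^ ((d : ℝ) / 2))
            * ((2 - ‖X‖ ^ 2) ^ ((d : ℝ) / 2) / Real.Gamma ((d : ℝ) / 2 + 1))|
          ≤ C * (1 / (n : ℝ))) ∧
    (∀ K : Set (EuclideanSpace ℝ (Fin d)), IsCompact K → (∀ X ∈ K, √2 < ‖X‖) →
      ∃ C c : ℝ, 0 < c ∧ ∀ᶠ n : ℕ in atTop, ∀ X ∈ K,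
        |scaledFermiKernel n X X| ≤ C * exp (-c * (n : ℝ))) := by
  obtain ⟨m, rfl⟩ := Nat.exists_eq_add_of_le' hd
  exact ⟨fun _ hK h => scaledFermiKernel_bulk m hK h,
    fun _ hK h => scaledFermiKernel_outside m hK h⟩
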